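/- **Setting.** For a $\mathbb{Q}$-divisor $D$ on $\mathbb{A}^1=\operatorname{Spec}\mathbb{C}[t]$ and $f\in\mathbb{C}(t)$, the condition $\operatorname{div} f+D\ge 0$ is understood to hold for $f=0$. For $\mathbb{Q}$-divisors $D_+,D_-$ on $\mathbb{A}^1$ with $D_++D_-\le 0$ let $A=\mathbb{C}[t][D_+,D_-]=\bigoplus_{i\in\mathbb{Z}}A_i\subseteq\mathbb{C}(t)[u,u^{-1}]$ be the graded ring with $$A_i=\{f\in\mathbb{C}(t)\mid \operatorname{div}f+iD_+\ge0\}\,u^i,\qquad A_{-i}=\{f\in\mathbb{C}(t)\mid \operatorname{div}f+iD_-\ge0\}\,u^{-i}\qquad(i\ge 0),$$ and let $V=\operatorname{Spec}A$, with the $\mathbb{C}^*$-action defined by $\lambda.a=\lambda^ia$ for $a\in A_i$. Suppose that $$D_+=-\frac{e_+}{d}[0],\quad 0<e_+\le d,\qquad D_-=-\frac{e_-}{d}[0]-\frac1kD_0,$$ where $d,e_+,k\ge1$ and $e_-$ are integers and $D_0$ is an integral divisor on $\mathbb{A}^1$ with $D_0(0)=0$, and let $Q\in\mathbb{C}[t]$,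 $Q\neq0$, be a polynomial with $\operatorname{div}(Q)=D_0$. (Then $e_++e_-\ge0$.) For an integer $\alpha\ge0$ put $$F=F_\alpha=x^ky-s^{k(e_++e_-)}\,Q(s^d/z)\,z^{\deg Q+\alpha}\in\mathbb{C}[x,y,z,s].$$ **Corollary 2.5.** Assume that (i) $k=1$, or (ii) $e_++e_-=0$ and $D_0$ is reduced. Then the following hold for every $\alpha\ge0$ (the case $\alpha=0$ being the original one; a large $\alpha$ makes all weights below positive). 1. The affine hypersurface $F(x,y,1,s)=0$ in $\mathbb{A}^3$ is normal, i.e. $\mathbb{C}[x,y,s]/(F(x,y,1,s))$ is an integrally closed domain. 2. $F$ is weighted homogeneous of degree $k(e_++e_-)+d(\deg Q+\alpha)$ for the weights $$\deg x=e_+,\quad \deg y=ke_-+d(\deg Q+\alpha),\quad\deg z=d,\quad\deg s=1,$$ and, with $R=\mathbb{C}[x,y,z,s]/(F)$ graded accordingly, there is an isomorphism of $\mathbb{C}$-algebras $A\cong (R[1/z])_0$ that is equivariant for the $\mathbb{C}^*$-action $\lambda.(x,y,z,s)=(\lambda x,\lambda^{-k}y,z,s)$ on $R$. That is, $V$ is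 equivariantly isomorphic to $\mathbb{D}_+(z)\cap\mathbb{V}_+(F)=\operatorname{Spec}(R[1/z])_0$, whatever the sign of $\deg y$. 3. If $b=ke_-+d(\deg Q+\alpha)\ge0$, then $V$ is equivariantly isomorphic over $\mathbb{C}$ to the principal open subset $\mathbb{D}_+(z)$ of the hypersurface $\mathbb{V}_+(F)=\operatorname{Proj}R$ in the weighted projective space $\mathbb{P}(e_+,b,d,1)=\operatorname{Proj}\mathbb{C}[x,y,z,s]$; the resulting morphism $V\to\mathbb{P}(e_+,b,d,1)$ is an immersion with image $\mathbb{D}_+(z)\cap\mathbb{V}_+(F)$. In particular, no normalization is needed. -/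

import Mathlib

open AlgebraicGeometry CategoryTheory Polynomial

noncomputable section

namespace CStarSurface

/-! ### The Dolgachev–Pinkham–Demazure ring `ℂ[t][D₊, D₋]` -/

/-- The order of vanishing at `p ∈ 𝔸¹` of a rational function (only meaningful for `f ≠ 0`). -/
def ordAt (f : RatFunc ℂ) (p : ℂ) : ℤ :=
  (f.num.rootMultiplicity p : ℤ) - (f.denom.rootMultiplicity p : ℤ)

/-- If `f = a / b` with `a ≠ 0`, the order of `f` can be computed from `a` and `b`. -/
theorem ordAt_eq {f : RatFunc ℂ} (p : ℂ) {a b : ℂ[X]} (ha : a ≠ 0)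
    (h : f.num * b = a * f.denom) :
    ordAt f p = (a.rootMultiplicity p : ℤ) - (b.rootMultiplicity p : ℤ) := by
  have hd := RatFunc.denom_ne_zero f
  have hr : a * f.denom ≠ 0 := mul_ne_zero ha hd
  have h1 := congrArg (Polynomial.rootMultiplicity p) h
  rw [Polynomial.rootMultiplicity_mul hr, Polynomial.rootMultiplicity_mul (h ▸ hr)] at h1
  unfold ordAt
  omega

theorem ordAt_mul {f g : RatFunc ℂ} (hf : f ≠ 0) (hg : g ≠ 0) (p : ℂ) :
    ordAt (f * g) p = ordAt f p + ordAt g p := by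
  have hn := mul_ne_zero (RatFunc.num_ne_zero hf) (RatFunc.num_ne_zero hg)
  have hd := mul_ne_zero (RatFunc.denom_ne_zero f) (RatFunc.denom_ne_zero g)
  rw [ordAt_eq p hn (RatFunc.num_denom_mul f g), Polynomial.rootMultiplicity_mul hn,
    Polynomial.rootMultiplicity_mul hd]
  unfold ordAt
  push_cast
  ring

theorem min_ordAt_le_ordAt_add {f g : RatFunc ℂ} (hf : f ≠ 0) (hg : g ≠ 0) (hfg : f + g ≠ 0)
    (p : ℂ) : min (ordAt f p) (ordAt g p) ≤ ordAt (f + g) p := by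
  have hn := RatFunc.num_mul_denom_add_denom_mul_num_ne_zero hfg
  have hfd := RatFunc.denom_ne_zero f
  have hgd := RatFunc.denom_ne_zero g
  rw [ordAt_eq p hn (RatFunc.num_denom_add f g)]
  have h1 := Polynomial.rootMultiplicity_add p hn
  rw [Polynomial.rootMultiplicity_mul (mul_ne_zero (RatFunc.num_ne_zero hf) hgd),
    Polynomial.rootMultiplicity_mul (mul_ne_zero hfd (RatFunc.num_ne_zero hg))] at h1
  rw [Polynomial.rootMultiplicity_mul (mul_ne_zero hfd hgd)]
  unfold ordAt
  omega

theorem ordAt_algebraMap (c p : ℂ) : ordAt (algebraMap ℂ (RatFunc ℂ) c) p = 0 := by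
  have h : algebraMap ℂ (RatFunc ℂ) c = RatFunc.C c := rfl
  rw [h]
  simp [ordAt]

/-- `{f ∈ ℂ(t) | div f + D ≥ 0}` for a `ℚ`-divisor `D` on the affine line `𝔸¹ = Spec ℂ[t]`,
where `ℚ`-divisors are finitely supported functions `ℂ → ℚ`. -/
def sections (D : ℂ →₀ ℚ) : Submodule ℂ (RatFunc ℂ) where
  carrier := {f | f = 0 ∨ ∀ p : ℂ, 0 ≤ (ordAt f p : ℚ) + D p}
  zero_mem' := Or.inl rfl
  add_mem' := by
    rintro f g hf hg
    by_cases hf0 : f = 0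
    · simpa [hf0] using hg
    by_cases hg0 : g = 0
    · simpa [hg0] using hf
    by_cases hfg : f + g = 0
    · exact Or.inl hfg
    refine Or.inr fun p => ?_
    have h1 := hf.resolve_left hf0 p
    have h2 := hg.resolve_left hg0 p
    have h3 : ((min (ordAt f p) (ordAt g p) : ℤ) : ℚ) ≤ (ordAt (f + g) p : ℚ) := by
      exact_mod_cast min_ordAt_le_ordAt_add hf0 hg0 hfg p
    rcases min_choice (ordAt f p) (ordAt g p) with h | h <;> rw [h] at h3 <;> linarith
  smul_mem' := by
    rintro c f hf
    by_cases hf0 : f = 0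
    · exact Or.inl (by simp [hf0])
    by_cases hc : c = 0
    · exact Or.inl (by simp [hc])
    refine Or.inr fun p => ?_
    have hc' : algebraMap ℂ (RatFunc ℂ) c ≠ 0 := by simpa using hc
    rw [Algebra.smul_def, ordAt_mul hc' hf0, ordAt_algebraMap, zero_add]
    exact hf.resolve_left hf0 p

theorem mul_mem_sections {D E G : ℂ →₀ ℚ} (h : ∀ p, D p + E p ≤ G p) {f g : RatFunc ℂ}
    (hf : f ∈ sections D) (hg : g ∈ sections E) : f * g ∈ sections G := by
  by_cases hf0 : f = 0
  · exact Or.inl (by simp [hf0])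
  by_cases hg0 : g = 0
  · exact Or.inl (by simp [hg0])
  refine Or.inr fun p => ?_
  have h1 := hf.resolve_left hf0 p
  have h2 := hg.resolve_left hg0 p
  have h3 := h p
  rw [ordAt_mul hf0 hg0]
  push_cast
  linarith

/-- The `ℚ`-divisor `i D₊` for `i ≥ 0` and `(-i) D₋` for `i < 0`. -/
def degreeDivisor (Dp Dm : ℂ →₀ ℚ) (i : ℤ) : ℂ →₀ ℚ :=
  if 0 ≤ i then (i : ℚ) • Dp else (-i : ℚ) • Dm

theorem degreeDivisor_add_le {Dp Dm : ℂ →₀ ℚ} (h : Dp + Dm ≤ 0) (i j : ℤ) (p : ℂ) :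
    degreeDivisor Dp Dm i p + degreeDivisor Dp Dm j p ≤ degreeDivisor Dp Dm (i + j) p := by
  have hp : Dp p + Dm p ≤ 0 := by simpa using h p
  unfold degreeDivisor
  split_ifs with h1 h2 h3 h3 h2 h3 h3 <;>
    simp only [Finsupp.smul_apply, smul_eq_mul, Int.cast_add] <;>
    first
    | (exfalso; omega)
    | skip
  all_goals
    have h1' : (0 : ℚ) ≤ i ∨ (i : ℚ) ≤ 0 := le_total _ _
    have h2' : (0 : ℚ) ≤ j ∨ (j : ℚ) ≤ 0 := le_total _ _
  · nlinarith
  · have : (j : ℚ) ≤ 0 := by exact_mod_cast (not_le.mp h2).le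
    nlinarith
  · have : (0 : ℚ) ≤ i := by exact_mod_cast h1
    nlinarith
  · have : (i : ℚ) ≤ 0 := by exact_mod_cast (not_le.mp h1).le
    nlinarith
  · have : (0 : ℚ) ≤ j := by exact_mod_cast h2
    nlinarith
  · nlinarith

/-- The graded ring `A = ℂ[t][D₊, D₋] = ⨁ Aᵢ ⊆ ℂ(t)[u, u⁻¹]`, where
`Aᵢ = {f | div f + i D₊ ≥ 0} uⁱ` and `A₋ᵢ = {f | div f + i D₋ ≥ 0} u⁻ⁱ` for `i ≥ 0`.
The variable `T` of the Laurent polynomial ring plays the role of `u`. -/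
def dpdRing (Dp Dm : ℂ →₀ ℚ) (h : Dp + Dm ≤ 0) :
    Subalgebra ℂ (LaurentPolynomial (RatFunc ℂ)) where
  carrier := {a | ∀ i : ℤ, a.coeff i ∈ sections (degreeDivisor Dp Dm i)}
  add_mem' ha hb i := by
    simpa using Submodule.add_mem _ (ha i) (hb i)
  mul_mem' {a b} ha hb i := by
    classical
    rw [AddMonoidAlgebra.coeff_mul]
    refine Submodule.sum_mem _ fun m₁ _ => Submodule.sum_mem _ fun m₂ _ => ?_
    dsimp only
    split_ifs with hm
    · subst hm
      exact mul_mem_sections (degreeDivisor_add_le h m₁ m₂) (ha m₁) (hb m₂)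
    · exact Submodule.zero_mem _
  algebraMap_mem' c i := by
    rw [AddMonoidAlgebra.coe_algebraMap, Function.comp_apply, AddMonoidAlgebra.coeff_single]
    by_cases hi : i = 0
    · subst hi
      refine Or.inr fun p => ?_
      rw [Finsupp.single_eq_same, ordAt_algebraMap]
      simp [degreeDivisor]
    · rw [Finsupp.single_eq_of_ne hi]
      exact Submodule.zero_mem _

/-- The automorphism of `ℂ(t)[u, u⁻¹]` given by `f uⁱ ↦ l ^ i f uⁱ`. -/
def laurentScale (l : ℂˣ) :
    LaurentPolynomial (RatFunc ℂ) →ₐ[RatFunc ℂ] LaurentPolynomial (RatFunc ℂ) :=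
  AddMonoidAlgebra.lift (RatFunc ℂ) (LaurentPolynomial (RatFunc ℂ)) ℤ
    { toFun := fun i =>
        AddMonoidAlgebra.single i.toAdd (algebraMap ℂ (RatFunc ℂ) ((l ^ i.toAdd : ℂˣ) : ℂ))
      map_one' := by
        rw [toAdd_one, zpow_zero, Units.val_one, map_one, AddMonoidAlgebra.one_def]
      map_mul' := fun i j => by
        rw [AddMonoidAlgebra.single_mul_single, toAdd_mul, zpow_add, Units.val_mul, map_mul] }

theorem coeff_laurentScale (l : ℂˣ) (a : LaurentPolynomial (RatFunc ℂ)) (i : ℤ) :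
    (laurentScale l a).coeff i = ((l ^ i : ℂˣ) : ℂ) • a.coeff i := by
  induction a using AddMonoidAlgebra.induction_linear with
  | zero => simp
  | add x y hx hy => simp [hx, hy]
  | single m r =>
    rw [laurentScale, AddMonoidAlgebra.lift_single]
    change (r • AddMonoidAlgebra.single m
      (algebraMap ℂ (RatFunc ℂ) ((l ^ m : ℂˣ) : ℂ))).coeff i = _
    rw [AddMonoidAlgebra.coeff_smul, Finsupp.smul_apply, AddMonoidAlgebra.coeff_single,
      AddMonoidAlgebra.coeff_single]
    by_cases hi : i = m
    · subst hi
      rw [Finsupp.single_eq_same, Finsupp.single_eq_same, smul_eq_mul, Algebra.smul_def, mul_comm]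
    · rw [Finsupp.single_eq_of_ne hi, Finsupp.single_eq_of_ne hi, smul_zero, smul_zero]

/-- The `ℂ^*`-action on `A = ⨁ Aᵢ` defined by the grading: `l . a = l ^ i a` for `a ∈ Aᵢ`. -/
def dpdTorus (Dp Dm : ℂ →₀ ℚ) (h : Dp + Dm ≤ 0) (l : ℂˣ) :
    dpdRing Dp Dm h →ₐ[ℂ] dpdRing Dp Dm h :=
  (((laurentScale l).restrictScalars ℂ).comp (dpdRing Dp Dm h).val).codRestrict _ fun a i => by
    simpa [coeff_laurentScale] using Submodule.smul_mem _ _ (a.2 i)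

/-! ### Weighted projective hypersurfaces -/

/-- The polynomial ring `ℂ[x, y, z, s]`, with `x, y, z, s` the variables `0, 1, 2, 3`. -/
abbrev Poly4 : Type := MvPolynomial (Fin 4) ℂ

/-- The polynomial `F = x ^ k y - s ^ (k (e₊ + e₋)) Q(s ^ d / z) z ^ (deg Q + α)`, written out in
terms of the coefficients of `Q`. -/
def surfacePoly (d k eP : ℕ) (eM : ℤ) (Q : ℂ[X]) (α : ℕ) : Poly4 :=
  MvPolynomial.X 0 ^ k * MvPolynomial.X 1 -
    MvPolynomial.X 3 ^ (k * ((eP : ℤ) + eM).toNat) *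
      ∑ j ∈ Finset.range (Q.natDegree + 1),
        MvPolynomial.C (Q.coeff j) * MvPolynomial.X 3 ^ (d * j) *
          MvPolynomial.X 2 ^ (Q.natDegree + α - j)

/-- The substitution `f(x, y, z, s) ↦ f(x, y, 1, s)`, with values in the polynomial ring
`ℂ[x, y, s]` in the variables `0, 1, 2`. -/
def dehomogenize : Poly4 →ₐ[ℂ] MvPolynomial (Fin 3) ℂ :=
  MvPolynomial.aeval ![MvPolynomial.X 0, MvPolynomial.X 1, 1, MvPolynomial.X 2]

/-- The grading of `ℂ[x, y, z, s]` by the weights `w`. -/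
abbrev polyGrading {M : Type} [AddCommMonoid M] (w : Fin 4 → M) : M → Submodule ℂ Poly4 :=
  MvPolynomial.weightedHomogeneousSubmodule ℂ w

instance {M : Type} [AddCommMonoid M] [DecidableEq M] (w : Fin 4 → M) :
    GradedAlgebra (polyGrading w) :=
  MvPolynomial.weightedGradedAlgebra ℂ w

/-- The grading of `R = ℂ[x, y, z, s] / (F)` induced by the weights `w`, for `F` weighted
homogeneous: `Rᵢ` is the image of the weighted homogeneous polynomials of degree `i`. -/
def hypGrading {M : Type} [AddCommMonoid M] (w : Fin 4 → M) (F : Poly4) {n : M}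
    (_hF : MvPolynomial.IsWeightedHomogeneous w F n) :
    M → Submodule ℂ (Poly4 ⧸ Ideal.span {F}) :=
  fun i => (polyGrading w i).map (Ideal.Quotient.mkₐ ℂ (Ideal.span {F})).toLinearMap

section Grading

variable {M : Type} [AddCommMonoid M] (w : Fin 4 → M) (F : Poly4) {n : M}
  (hF : MvPolynomial.IsWeightedHomogeneous w F n)

theorem mk_mem_hypGrading {i : M} {f : Poly4} (hf : f ∈ polyGrading w i) :
    Ideal.Quotient.mk (Ideal.span {F}) f ∈ hypGrading w F hF i :=
  ⟨f, hf, rfl⟩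

instance : SetLike.GradedMonoid (hypGrading w F hF) where
  one_mem := ⟨1, MvPolynomial.isWeightedHomogeneous_one ℂ w, rfl⟩
  mul_mem := by
    rintro i j _ _ ⟨f, hf, rfl⟩ ⟨g, hg, rfl⟩
    exact ⟨f * g, MvPolynomial.IsWeightedHomogeneous.mul hf hg, rfl⟩

variable [DecidableEq M]

theorem span_isHomogeneous (hF : MvPolynomial.IsWeightedHomogeneous w F n) :
    (Ideal.span {F}).IsHomogeneous (polyGrading w) :=
  Ideal.homogeneous_span _ _ fun x hx => ⟨n, by rw [Set.mem_singleton_iff.mp hx]; exact hF⟩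

/-- The decomposition of a polynomial into its weighted homogeneous components, reduced
modulo `F`. -/
def hypDecomposeAux : Poly4 →ₗ[ℂ] DirectSum M fun i => hypGrading w F hF i :=
  (DirectSum.lmap fun i =>
    ((Ideal.Quotient.mkₐ ℂ (Ideal.span {F})).toLinearMap.restrict
      (fun _ hx => mk_mem_hypGrading w F hF hx) :
        polyGrading w i →ₗ[ℂ] hypGrading w F hF i)) ∘ₗ
    (DirectSum.decomposeLinearEquiv (polyGrading w)).toLinearMap

theorem hypDecomposeAux_of_mem {i : M} {f : Poly4} (hf : f ∈ polyGrading w i) :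
    hypDecomposeAux w F hF f = DirectSum.lof ℂ M (fun i => hypGrading w F hF i) i
      ⟨Ideal.Quotient.mk (Ideal.span {F}) f, mk_mem_hypGrading w F hF hf⟩ := by
  rw [hypDecomposeAux, LinearMap.comp_apply, LinearEquiv.coe_coe,
    DirectSum.decomposeLinearEquiv_apply, DirectSum.decompose_of_mem _ hf,
    ← DirectSum.lof_eq_of ℂ, DirectSum.lmap_lof]
  rfl

theorem hypDecomposeAux_eq_zero {f : Poly4} (hf : f ∈ Ideal.span {F}) :
    hypDecomposeAux w F hF f = 0 := by
  rw [hypDecomposeAux, LinearMap.comp_apply, LinearEquiv.coe_coe,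
    DirectSum.decomposeLinearEquiv_apply]
  refine DFinsupp.ext fun i => Subtype.ext ?_
  rw [DirectSum.lmap_apply]
  exact Ideal.Quotient.eq_zero_iff_mem.mpr (span_isHomogeneous w F hF i hf)

/-- The decomposition of `R = ℂ[x, y, z, s] / (F)` into its graded pieces. -/
def hypDecompose :
    (Poly4 ⧸ Ideal.span {F}) →ₗ[ℂ] DirectSum M fun i => hypGrading w F hF i :=
  (((Ideal.span {F}).restrictScalars ℂ).liftQ
    (M₂ := DirectSum M fun i => hypGrading w F hF i) (hypDecomposeAux w F hF)
    fun _ hf => LinearMap.mem_ker.mpr (hypDecomposeAux_eq_zero w F hF hf)) ∘ₗ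
    (Submodule.Quotient.restrictScalarsEquiv ℂ (Ideal.span {F})).symm.toLinearMap

theorem hypDecompose_mk (f : Poly4) :
    hypDecompose w F hF (Ideal.Quotient.mk (Ideal.span {F}) f) = hypDecomposeAux w F hF f :=
  rfl

theorem coe_hypDecomposeAux (f : Poly4) :
    DirectSum.coeLinearMap (hypGrading w F hF) (hypDecomposeAux w F hF f) =
      Ideal.Quotient.mk (Ideal.span {F}) f := by
  induction f using DirectSum.Decomposition.inductionOn (polyGrading w) with
  | zero => simp
  | @homogeneous i f =>
    rw [hypDecomposeAux_of_mem w F hF f.2, DirectSum.coeLinearMap_lof]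
  | add f g hf hg => rw [map_add, map_add, hf, hg, map_add]

instance : GradedAlgebra (hypGrading w F hF) where
  toDecomposition := DirectSum.Decomposition.ofLinearMap _ (hypDecompose w F hF)
    (by
      refine LinearMap.ext fun r => ?_
      obtain ⟨f, rfl⟩ := Ideal.Quotient.mk_surjective r
      rw [LinearMap.comp_apply, hypDecompose_mk, coe_hypDecomposeAux]
      rfl)
    (by
      refine DirectSum.linearMap_ext ℂ fun i => LinearMap.ext fun r => ?_
      obtain ⟨_, f, hf, rfl⟩ := r
      rw [LinearMap.comp_apply, LinearMap.comp_apply, DirectSum.coeLinearMap_lof]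
      exact hypDecomposeAux_of_mem w F hF hf)

end Grading

/-! ### The torus actions -/

/-- The diagonal substitution `f(X) ↦ f(c • X)`. -/
def scale (c : Fin 4 → ℂ) : Poly4 →ₐ[ℂ] Poly4 :=
  MvPolynomial.aeval fun i => MvPolynomial.C (c i) * MvPolynomial.X i

theorem coeff_scale (c : Fin 4 → ℂ) (f : Poly4) (m : Fin 4 →₀ ℕ) :
    (scale c f).coeff m = (m.prod fun i e => c i ^ e) * f.coeff m := by
  classical
  induction f using MvPolynomial.induction_on' with
  | add p q hp hq => rw [map_add, MvPolynomial.coeff_add, MvPolynomial.coeff_add, hp, hq, mul_add]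
  | monomial u a =>
    have h : scale c (MvPolynomial.monomial u a) =
        MvPolynomial.monomial u ((u.prod fun i e => c i ^ e) * a) := by
      rw [scale, MvPolynomial.aeval_monomial, MvPolynomial.monomial_eq (s := u),
        MvPolynomial.algebraMap_eq, map_mul, Finsupp.prod, Finsupp.prod, Finsupp.prod, map_prod,
        mul_comm (∏ _ ∈ _, _) (MvPolynomial.C a), mul_assoc, ← Finset.prod_mul_distrib]
      simp only [mul_pow, map_pow]
    rw [h, MvPolynomial.coeff_monomial, MvPolynomial.coeff_monomial]
    split_ifs with hu
    · rw [hu]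
    · rw [mul_zero]

/-- The action of `l ∈ ℂ^*` on `ℂ[x, y, z, s]` given by `x ↦ l x`, `y ↦ l ^ (-k) y`, `z ↦ z`,
`s ↦ s`. -/
def torusScale (k : ℕ) (l : ℂˣ) : Poly4 →ₐ[ℂ] Poly4 :=
  scale ![(l : ℂ), ((l ^ (-(k : ℤ)) : ℂˣ) : ℂ), 1, 1]

theorem torusScale_surfacePoly (d k eP : ℕ) (eM : ℤ) (Q : ℂ[X]) (α : ℕ) (l : ℂˣ) :
    torusScale k l (surfacePoly d k eP eM Q α) = surfacePoly d k eP eM Q α := by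
  have h0 : torusScale k l (MvPolynomial.X 0) = MvPolynomial.C (l : ℂ) * MvPolynomial.X 0 := by
    simp [torusScale, scale]
  have h1 : torusScale k l (MvPolynomial.X 1) =
      MvPolynomial.C ((l ^ (-(k : ℤ)) : ℂˣ) : ℂ) * MvPolynomial.X 1 := by
    simp [torusScale, scale]
  have h2 : torusScale k l (MvPolynomial.X 2) = MvPolynomial.X 2 := by
    simp [torusScale, scale]
  have h3 : torusScale k l (MvPolynomial.X 3) = MvPolynomial.X 3 := by
    simp [torusScale, scale]
  have hC : ∀ c : ℂ, torusScale k l (MvPolynomial.C c) = MvPolynomial.C c := fun c =>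
    (torusScale k l).commutes c
  have hl : (MvPolynomial.C (l : ℂ) : Poly4) ^ k *
      MvPolynomial.C ((l ^ (-(k : ℤ)) : ℂˣ) : ℂ) = 1 := by
    rw [← map_pow, ← map_mul, ← Units.val_pow_eq_pow_val, ← Units.val_mul, zpow_neg,
      zpow_natCast, mul_inv_cancel, Units.val_one, map_one]
  simp only [surfacePoly, map_sub, map_mul, map_pow, map_sum, h0, h1, h2, h3, hC]
  congr 1
  rw [mul_pow, mul_mul_mul_comm, hl, one_mul]

theorem torusScale_torusScale_inv (k : ℕ) (l : ℂˣ) (f : Poly4) :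
    torusScale k l (torusScale k l⁻¹ f) = f := by
  ext m
  rw [torusScale, torusScale, coeff_scale, coeff_scale, ← mul_assoc, Finsupp.prod, Finsupp.prod,
    ← Finset.prod_mul_distrib, Finset.prod_eq_one, one_mul]
  intro i _
  rw [← mul_pow]
  fin_cases i <;> simp

section Torus

variable {M : Type} [AddCommMonoid M] (w : Fin 4 → M) (F : Poly4) {n : M}
  (hF : MvPolynomial.IsWeightedHomogeneous w F n) (k : ℕ)
  (hinv : ∀ l : ℂˣ, torusScale k l F = F)

/-- The graded automorphism of `R = ℂ[x, y, z, s] / (F)` induced by `torusScale k l`, for `F`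
invariant under the torus. -/
def hypTorus (l : ℂˣ) : GradedRingHom (hypGrading w F hF) (hypGrading w F hF) where
  toRingHom := Ideal.quotientMap (Ideal.span {F}) (torusScale k l).toRingHom (by
    rw [Ideal.span_singleton_le_iff_mem, Ideal.mem_comap]
    change torusScale k l F ∈ _
    rw [hinv l]
    exact Ideal.mem_span_singleton_self F)
  map_mem := by
    rintro i _ ⟨f, hf, rfl⟩
    refine mk_mem_hypGrading w F hF (f := torusScale k l f) ?_
    intro m hm
    refine hf (d := m) fun h0 => hm ?_
    rw [torusScale, coeff_scale, h0, mul_zero]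

/-- The class of `z` in `R = ℂ[x, y, z, s] / (F)`. -/
def zClass : Poly4 ⧸ Ideal.span {F} := Ideal.Quotient.mk (Ideal.span {F}) (MvPolynomial.X 2)

theorem hypTorus_zClass (l : ℂˣ) : hypTorus w F hF k hinv l (zClass F) = zClass F := by
  change Ideal.Quotient.mk (Ideal.span {F}) (torusScale k l (MvPolynomial.X 2)) = _
  rw [torusScale, scale, MvPolynomial.aeval_X]
  simp [zClass]

/-- The coordinate ring `(R[1/z])₀` of the principal open subset `D₊(z)` of the hypersurface
`F = 0` for the weights `w`; it makes sense for integral weights of any sign. -/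
abbrev ChartRing : Type := HomogeneousLocalization.Away (hypGrading w F hF) (zClass F)

/-- The action of the torus on `(R[1/z])₀`. -/
def chartTorus [DecidableEq M] (l : ℂˣ) : ChartRing w F hF →+* ChartRing w F hF :=
  HomogeneousLocalization.map (hypTorus w F hF k hinv l) (by
    rw [Submonoid.powers_le]
    change hypTorus w F hF k hinv l (zClass F) ∈ Submonoid.powers (zClass F)
    rw [hypTorus_zClass]
    exact Submonoid.mem_powers _)

end Torus

/-! ### The geometry, for weights in `ℕ` -/

section Geometry

variable (w : Fin 4 → ℕ) (F : Poly4) {n : ℕ}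
  (hF : MvPolynomial.IsWeightedHomogeneous w F n) (k : ℕ)
  (hinv : ∀ l : ℂˣ, torusScale k l F = F)

/-- The weighted projective space `ℙ(w)`. -/
abbrev WeightedProj : Scheme.{0} := Proj (polyGrading w)

/-- The weighted projective hypersurface `V₊(F) = Proj (ℂ[x, y, z, s] / (F))`. -/
abbrev Hypersurface : Scheme.{0} := Proj (hypGrading w F hF)

/-- The quotient map `ℂ[x, y, z, s] → ℂ[x, y, z, s] / (F)` as a graded homomorphism. -/
def hypQuotient : GradedRingHom (polyGrading w) (hypGrading w F hF) where
  toRingHom := Ideal.Quotient.mk (Ideal.span {F})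
  map_mem hf := mk_mem_hypGrading w F hF hf

/-- The inclusion `V₊(F) ⟶ ℙ(w)`. -/
def hypInclusion : Hypersurface w F hF ⟶ WeightedProj w :=
  Proj.map (hypQuotient w F hF) (by
    refine (HomogeneousIdeal.toIdeal_irrelevant_le _).mpr ?_
    rintro i hi _ ⟨f, hf, rfl⟩
    exact Ideal.mem_map_of_mem (hypQuotient w F hF)
      (HomogeneousIdeal.mem_irrelevant_of_mem _ hi hf))

/-- The action of `l ∈ ℂ^*` on `V₊(F)` induced by `torusScale k l`. -/
def hypersurfaceTorus (l : ℂˣ) : Hypersurface w F hF ⟶ Hypersurface w F hF :=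
  Proj.map (hypTorus w F hF k hinv l) (by
    refine (HomogeneousIdeal.toIdeal_irrelevant_le _).mpr ?_
    intro i hi r hr
    have h := Ideal.mem_map_of_mem (hypTorus w F hF k hinv l)
      (HomogeneousIdeal.mem_irrelevant_of_mem _ hi ((hypTorus w F hF k hinv l⁻¹).map_mem hr))
    obtain ⟨f, rfl⟩ := Ideal.Quotient.mk_surjective r
    have h' : hypTorus w F hF k hinv l (hypTorus w F hF k hinv l⁻¹
        (Ideal.Quotient.mk (Ideal.span {F}) f)) = Ideal.Quotient.mk (Ideal.span {F}) f :=
      congrArg _ (torusScale_torusScale_inv k l f)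
    rw [← h']
    exact h)

/-- The structure morphism `V₊(F) ⟶ Spec ℂ`. -/
def hypersurfaceToSpec : Hypersurface w F hF ⟶ Spec (CommRingCat.of ℂ) :=
  Proj.toSpecZero (hypGrading w F hF) ≫
    Spec.map (CommRingCat.ofHom (algebraMap ℂ (hypGrading w F hF 0)))

end Geometry

end CStarSurface

end

open CStarSurface

/-! Everything takes place inside `ℂ(t)[u, u⁻¹]`. Put `N = deg Q + α` and send `x ↦ u`, `y ↦ Q t ^
(-N) u ^ (-k)`, `z ↦ t⁻¹`, `s ↦ 1`, so that the degree-zero element `s ^ d / z` becomes `t`. A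
monomial `x ^ a y ^ b z ^ e s ^ c / z ^ r` goes to `Q ^ b t ^ j u ^ (a - k b)` with `j = r - e - N
b`. It has degree zero exactly when `c = d j - (e₊ a + k e₋ b)`. Hence `c ≥ 0` is the inequality `e₊
a + k e₋ b ≤ d j`, and this inequality puts the image in `A` (`monomial_mem_sections`).

Conversely, every homogeneous element of `A` is such a `Q ^ b t ^ j u ^ (a - k b)` times a
polynomial in `t` (`exists_eq_of_mem_sections`). This is where the two cases enter: in degree `-n`
the choice `b = ⌈n / k⌉` must lose nothing, neither at `0` nor at the roots of `Q`. So the image of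
`(R[1/z])₀` is all of `A`.

For injectivity, a homogeneous `f` in the kernel is multiplied by a power of `x` to eliminate `y`
with the relation `x ^ k y = G`. Monomials in `x, z, s` of one fixed degree have different images,
so the result vanishes, and `F` divides `x ^ m f`. Since `x` is prime and does not divide `F`, it
follows that `F` divides `f` (`dvd_of_map_eq_zero`).

Normality comes from the same description. Put `m = e₊ + e₋`. The affine surface `x ^ k y = s ^ (k
m) Q(s ^ d)` has as coordinate ring the ring of the divisors `0` and `-m [0] - (1/k) div Q(s ^ d)`,
and every ring `ℂ[t][D₊, D₋]` is normal. Indeed its integral closure in the normal ring `ℂ(t)[u,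
u⁻¹]` is stable under the torus, hence graded, and for a homogeneous element integrality forces the
required bound on the order at each point.

The statements about `Proj` follow because `D₊(z)` is the spectrum of `(R[1/z])₀`. -/

namespace CStarSurface

/-! ### Orders of vanishing -/

theorem ordAt_polynomial (q : ℂ[X]) (p : ℂ) :
    ordAt (algebraMap ℂ[X] (RatFunc ℂ) q) p = q.rootMultiplicity p := by
  simp [ordAt]

theorem ordAt_one (p : ℂ) : ordAt 1 p = 0 := by simp [ordAt]

theorem ordAt_pow {f : RatFunc ℂ} (hf : f ≠ 0) (n : ℕ) (p : ℂ) :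
    ordAt (f ^ n) p = n * ordAt f p := by
  induction n with
  | zero => simp [ordAt_one]
  | succ n ih =>
    rw [pow_succ, ordAt_mul (pow_ne_zero n hf) hf, ih]
    push_cast
    ring

theorem ordAt_inv {f : RatFunc ℂ} (hf : f ≠ 0) (p : ℂ) : ordAt f⁻¹ p = -ordAt f p := by
  have h := ordAt_mul hf (inv_ne_zero hf) p
  rw [mul_inv_cancel₀ hf, ordAt_one] at h
  omega

theorem ordAt_zpow {f : RatFunc ℂ} (hf : f ≠ 0) (n : ℤ) (p : ℂ) :
    ordAt (f ^ n) p = n * ordAt f p := by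
  cases n with
  | ofNat n => simpa using ordAt_pow hf n p
  | negSucc n =>
    rw [zpow_negSucc, ordAt_inv (pow_ne_zero _ hf), ordAt_pow hf, Int.negSucc_eq]
    push_cast
    ring

theorem ordAt_X_zero : ordAt RatFunc.X 0 = 1 := by
  rw [← RatFunc.algebraMap_X, ordAt_polynomial]
  simpa using Polynomial.rootMultiplicity_X_sub_C_self (x := (0 : ℂ))

theorem ordAt_X_of_ne {p : ℂ} (hp : p ≠ 0) : ordAt RatFunc.X p = 0 := by
  rw [← RatFunc.algebraMap_X, ordAt_polynomial]
  simp [Polynomial.rootMultiplicity_eq_zero, hp]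

/-- A rational function without poles is a polynomial. -/
theorem exists_polynomial_of_ordAt_nonneg {f : RatFunc ℂ} (h : ∀ p, 0 ≤ ordAt f p) :
    ∃ q : ℂ[X], f = algebraMap ℂ[X] (RatFunc ℂ) q := by
  have hd : f.denom.natDegree = 0 := by
    by_contra hne
    obtain ⟨p, hp⟩ := IsAlgClosed.exists_root f.denom fun h0 =>
      hne (Polynomial.natDegree_eq_of_degree_eq_some h0)
    have h1 : 0 < f.denom.rootMultiplicity p :=
      (Polynomial.rootMultiplicity_pos (RatFunc.denom_ne_zero f)).mpr hp
    have h2 : f.num.rootMultiplicity p = 0 := by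
      refine Polynomial.rootMultiplicity_eq_zero fun hn => ?_
      obtain ⟨a, b, hab⟩ := RatFunc.isCoprime_num_denom f
      have := congrArg (Polynomial.eval p) hab
      rw [Polynomial.eval_add, Polynomial.eval_mul, Polynomial.eval_mul, hn.eq_zero,
        hp.eq_zero] at this
      simp at this
    have h3 := h p
    unfold ordAt at h3
    omega
  have h1 : f.denom = 1 := (RatFunc.monic_denom f).natDegree_eq_zero.mp hd
  exact ⟨f.num, by conv_lhs => rw [← RatFunc.num_div_denom f, h1, map_one, div_one]⟩

theorem exists_eq_mul_polynomial {f h : RatFunc ℂ} (hf : f ≠ 0) (hh : h ≠ 0)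
    (hle : ∀ p, ordAt h p ≤ ordAt f p) :
    ∃ q : ℂ[X], f = h * algebraMap ℂ[X] (RatFunc ℂ) q := by
  obtain ⟨q, hq⟩ := exists_polynomial_of_ordAt_nonneg (f := h⁻¹ * f) fun p => by
    rw [ordAt_mul (inv_ne_zero hh) hf, ordAt_inv hh]
    linarith [hle p]
  exact ⟨q, by rw [← hq, mul_inv_cancel_left₀ hh]⟩

/-- Ultrametric inequality for finite sums. The alternative `= 0` stands for order `∞`, since `ordAt
0 p` has the default value `0`. -/
theorem sum_eq_zero_or_lt_ordAt {ι : Type*} (s : Finset ι) (f : ι → RatFunc ℂ) (p : ℂ) (c : ℤ)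
    (h : ∀ i ∈ s, f i = 0 ∨ c < ordAt (f i) p) :
    ∑ i ∈ s, f i = 0 ∨ c < ordAt (∑ i ∈ s, f i) p := by
  classical
  induction s using Finset.induction_on with
  | empty => simp
  | insert a s ha ih =>
    rw [Finset.sum_insert ha]
    have h1 := h a (Finset.mem_insert_self a s)
    have h2 := ih fun i hi => h i (Finset.mem_insert_of_mem hi)
    by_cases ha0 : f a = 0
    · simpa [ha0] using h2
    by_cases hs0 : ∑ i ∈ s, f i = 0
    · simpa [hs0] using h1
    by_cases hsum : f a + ∑ i ∈ s, f i = 0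
    · exact Or.inl hsum
    exact Or.inr (lt_of_lt_of_le (lt_min (h1.resolve_left ha0) (h2.resolve_left hs0))
      (min_ordAt_le_ordAt_add ha0 hs0 hsum p))

/-! ### The ring `ℂ[t][D₊, D₋]` is normal -/

/-- The divisor is linear on each of the two half-lines of degrees, and multiplication by `n ≥ 0`
stays on one of them. -/
theorem degreeDivisor_natCast_mul (Dp Dm : ℂ →₀ ℚ) (n : ℕ) (i : ℤ) (p : ℂ) :
    degreeDivisor Dp Dm (n * i) p = n * degreeDivisor Dp Dm i p := by
  unfold degreeDivisor
  rcases Nat.eq_zero_or_pos n with rfl | hn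
  · simp
  have : 0 ≤ (n : ℤ) * i ↔ 0 ≤ i := mul_nonneg_iff_of_pos_left (by exact_mod_cast hn)
  simp only [this]
  split_ifs <;> simp [mul_assoc]

section Normality

variable {Dp Dm : ℂ →₀ ℚ} (h : Dp + Dm ≤ 0)

/-- A valuation argument at one point `p`. Let `Dᵢ` be the divisor in degree `i`, and suppose `ord g
< -Dᵢ(p)`. In an integral equation of degree `N`, the term with `g ^ j`, `j < N`, has order at least
`-(N - j) Dᵢ(p) + j ord g > N ord g` unless it vanishes, so nothing can cancel `g ^ N`. -/
theorem mem_sections_of_isIntegral_single {i : ℤ} {g : RatFunc ℂ}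
    (hg : IsIntegral (dpdRing Dp Dm h) (AddMonoidAlgebra.single i g :
      LaurentPolynomial (RatFunc ℂ))) :
    g ∈ sections (degreeDivisor Dp Dm i) := by
  by_cases hg0 : g = 0
  · exact Or.inl hg0
  refine Or.inr fun p => ?_
  by_contra! hlt
  obtain ⟨P, hP, hev⟩ := hg
  set N := P.natDegree with hN
  rw [Polynomial.eval₂_eq_sum_range] at hev
  -- Only the component of degree `N i` matters: the coefficient of `g ^ j` contributes its
  -- component of degree `(N - j) i`.
  have hc := congrArg (fun a : LaurentPolynomial (RatFunc ℂ) => a.coeff (N * i)) hev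
  have hterm : ∀ j : ℕ, ((algebraMap (dpdRing Dp Dm h) (LaurentPolynomial (RatFunc ℂ))) (P.coeff j)
      * (AddMonoidAlgebra.single i g : LaurentPolynomial (RatFunc ℂ)) ^ j).coeff (N * i) =
      (P.coeff j : LaurentPolynomial (RatFunc ℂ)).coeff (N * i - j * i) * g ^ j := by
    intro j
    rw [AddMonoidAlgebra.single_pow, AddMonoidAlgebra.coeff_mul_single_apply]
    simp only [nsmul_eq_mul, sub_eq_add_neg]
    rfl
  simp only [AddMonoidAlgebra.coeff_sum, Finsupp.finsetSum_apply, hterm, AddMonoidAlgebra.coeff_zero,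
    Finsupp.coe_zero, Pi.zero_apply] at hc
  rw [Finset.sum_range_succ, ← hN] at hc
  have hlead : (P.coeff N : LaurentPolynomial (RatFunc ℂ)).coeff (N * i - N * i) = 1 := by
    rw [hN, Polynomial.coeff_natDegree, hP.leadingCoeff]
    rw [sub_self, OneMemClass.coe_one, AddMonoidAlgebra.one_def, AddMonoidAlgebra.coeff_single,
      Finsupp.single_eq_same]
  rw [hlead, one_mul] at hc
  have hlow := sum_eq_zero_or_lt_ordAt (Finset.range N)
    (fun j => (P.coeff j : LaurentPolynomial (RatFunc ℂ)).coeff (N * i - j * i) * g ^ j) p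
    (N * ordAt g p) (by
      intro j hj
      have hjN : j < N := Finset.mem_range.mp hj
      have hmem := (P.coeff j).2 (N * i - j * i)
      rcases hmem with h0 | hmem
      · exact Or.inl (by rw [h0, zero_mul])
      by_cases hb : (P.coeff j : LaurentPolynomial (RatFunc ℂ)).coeff (N * i - j * i) = 0
      · exact Or.inl (by rw [hb, zero_mul])
      refine Or.inr ?_
      rw [ordAt_mul hb (pow_ne_zero j hg0), ordAt_pow hg0]
      have h1 := hmem p
      have h2 : (N : ℤ) * i - j * i = ((N - j : ℕ) : ℤ) * i := by
        rw [Nat.cast_sub hjN.le]; ring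
      rw [show degreeDivisor Dp Dm (N * i - j * i) p = ((N - j : ℕ) : ℚ) *
        degreeDivisor Dp Dm i p by rw [h2, degreeDivisor_natCast_mul]] at h1
      have h3 : (0 : ℚ) < ((N - j : ℕ) : ℚ) := by exact_mod_cast Nat.sub_pos_of_lt hjN
      have h4 := mul_neg_of_pos_of_neg h3 hlt
      have h5 : ((N - j : ℕ) : ℚ) = N - j := by rw [Nat.cast_sub hjN.le]
      rw [h5] at h1 h4
      have h6 : (N * ordAt g p : ℚ) < (ordAt ((P.coeff j :
          LaurentPolynomial (RatFunc ℂ)).coeff (N * i - j * i)) p : ℚ) + j * ordAt g p := by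
        linarith
      exact_mod_cast h6)
  have hsum := eq_neg_of_add_eq_zero_left hc
  have hne : -g ^ N ≠ 0 := neg_ne_zero.mpr (pow_ne_zero N hg0)
  rw [hsum] at hlow
  have h7 := hlow.resolve_left hne
  have h8 : ordAt (-g ^ N) p = N * ordAt g p := by
    rw [← neg_one_mul, ordAt_mul (by simp) (pow_ne_zero N hg0), ordAt_pow hg0]
    have : (-1 : RatFunc ℂ) = algebraMap ℂ (RatFunc ℂ) (-1) := by simp
    rw [this, ordAt_algebraMap, zero_add]
  omega

/-- The torus preserves the base ring, so it can be applied to the coefficients of an integral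
equation. -/
theorem isIntegral_laurentScale {l : ℂˣ} {a : LaurentPolynomial (RatFunc ℂ)}
    (ha : IsIntegral (dpdRing Dp Dm h) a) : IsIntegral (dpdRing Dp Dm h) (laurentScale l a) :=
  ha.map_of_comp_eq (dpdTorus Dp Dm h l).toRingHom (laurentScale l).toRingHom rfl

/-- A subspace of `ℂ(t)[u, u⁻¹]` that is stable under the torus contains the homogeneous components
of its elements. -/
theorem single_coeff_mem_of_laurentScale_mem
    (W : Submodule ℂ (LaurentPolynomial (RatFunc ℂ)))
    (hW : ∀ (l : ℂˣ), ∀ a ∈ W, laurentScale l a ∈ W)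
    {a : LaurentPolynomial (RatFunc ℂ)} (ha : a ∈ W) (i : ℤ) :
    AddMonoidAlgebra.single i (a.coeff i) ∈ W := by
  classical
  induction hn : a.coeff.support.card using Nat.strong_induction_on generalizing a i with
  | _ n ih =>
  -- Any `l` that is not a root of unity would do, as its powers are pairwise different.
  set l : ℂˣ := Units.mk0 2 two_ne_zero
  by_cases hi : a.coeff i = 0
  · rw [hi, AddMonoidAlgebra.single_zero]; exact W.zero_mem
  -- Passing from `a` to `l . a - l ^ r a` removes the component of degree `r` and multiplies that
  -- of degree `j` by `l ^ j - l ^ r ≠ 0`; this drives the induction on the size of the support.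
  -- With `r = i` it yields all components except the `i`-th, which is then obtained by subtraction.
  have key : ∀ j, j ≠ i → ∀ r ∈ a.coeff.support, r ≠ j →
      AddMonoidAlgebra.single j (a.coeff j) ∈ W := by
    intro j hji r hr hrj
    set b := laurentScale l a - ((l ^ r : ℂˣ) : ℂ) • a with hb
    have hbW : b ∈ W := W.sub_mem (hW l a ha) (W.smul_mem _ ha)
    have hbc : ∀ s, b.coeff s = (((l ^ s : ℂˣ) : ℂ) - ((l ^ r : ℂˣ) : ℂ)) • a.coeff s := by
      intro s
      rw [hb, AddMonoidAlgebra.coeff_sub, Finsupp.sub_apply, coeff_laurentScale,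
        AddMonoidAlgebra.coeff_smul_apply, sub_smul]
    have hcard : b.coeff.support.card < n := by
      rw [← hn]
      refine Finset.card_lt_card ⟨fun s hs => ?_, fun hsub => ?_⟩
      · rw [Finsupp.mem_support_iff, hbc] at hs
        rw [Finsupp.mem_support_iff]
        exact fun h0 => hs (by rw [h0, smul_zero])
      · have := hsub hr
        rw [Finsupp.mem_support_iff, hbc] at this
        simp at this
    have h1 := ih _ hcard hbW j rfl
    rw [hbc, ← AddMonoidAlgebra.smul_single] at h1
    have hne : ((l ^ j : ℂˣ) : ℂ) - ((l ^ r : ℂˣ) : ℂ) ≠ 0 := by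
      rw [sub_ne_zero, Units.val_zpow_eq_zpow_val, Units.val_zpow_eq_zpow_val]
      intro heq
      have h2 : ((2 : ℝ) : ℂ) ^ j = ((2 : ℝ) : ℂ) ^ r := by simpa [l] using heq
      have h3 : (2 : ℝ) ^ j = 2 ^ r := by exact_mod_cast h2
      exact hrj (zpow_right_injective₀ (by norm_num) (by norm_num) h3).symm
    have h2 := W.smul_mem (((l ^ j : ℂˣ) : ℂ) - ((l ^ r : ℂˣ) : ℂ))⁻¹ h1
    rwa [inv_smul_smul₀ hne] at h2
  have hsum : a = AddMonoidAlgebra.single i (a.coeff i) +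
      ∑ j ∈ a.coeff.support.erase i, AddMonoidAlgebra.single j (a.coeff j) := by
    rw [Finset.add_sum_erase _ (fun j => (AddMonoidAlgebra.single j (a.coeff j) :
      LaurentPolynomial (RatFunc ℂ))) (Finsupp.mem_support_iff.mpr hi)]
    exact (AddMonoidAlgebra.sum_coeff_single a).symm
  rw [eq_sub_of_add_eq hsum.symm]
  refine W.sub_mem ha (W.sum_mem fun j hj => ?_)
  exact key j (Finset.ne_of_mem_erase hj) i (Finsupp.mem_support_iff.mpr hi)
    (Finset.ne_of_mem_erase hj).symm

theorem mem_dpdRing_of_isIntegral {a : LaurentPolynomial (RatFunc ℂ)}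
    (ha : IsIntegral (dpdRing Dp Dm h) a) : a ∈ dpdRing Dp Dm h := by
  intro i
  refine mem_sections_of_isIntegral_single h ?_
  exact single_coeff_mem_of_laurentScale_mem
    ((integralClosure (dpdRing Dp Dm h) (LaurentPolynomial (RatFunc ℂ))).restrictScalars
      ℂ).toSubmodule
    (fun l a ha => isIntegral_laurentScale h ha) ha i

theorem isIntegrallyClosed_laurentPolynomial (K : Type*) [Field K] :
    IsIntegrallyClosed (LaurentPolynomial K) :=
  isIntegrallyClosed_of_isLocalization _ (Submonoid.powers (Polynomial.X : K[X]))
    (powers_le_nonZeroDivisors_of_noZeroDivisors Polynomial.X_ne_zero)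

/-- A subring of a normal domain that is integrally closed in it is normal. -/
theorem isIntegrallyClosed_of_isIntegrallyClosedIn (R S : Type*) [CommRing R] [IsDomain R]
    [CommRing S] [IsDomain S] [Algebra R S] [IsIntegrallyClosed S] [IsIntegrallyClosedIn R S] :
    IsIntegrallyClosed R := by
  have hinj : Function.Injective (algebraMap R S) := IsIntegralClosure.algebraMap_injective R R S
  rw [isIntegrallyClosed_iff (FractionRing R)]
  intro x hx
  set φ : FractionRing R →+* FractionRing S := IsFractionRing.map hinj
  have hφ : φ.comp (algebraMap R (FractionRing R)) =
      (algebraMap S (FractionRing S)).comp (algebraMap R S) :=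
    IsLocalization.map_comp _
  have h1 : IsIntegral S (φ x) := hx.map_of_comp_eq (algebraMap R S) φ hφ.symm
  obtain ⟨s, hs⟩ := (isIntegrallyClosed_iff (FractionRing S)).mp ‹_› h1
  have h2 : IsIntegral R s := by
    obtain ⟨P, hP, hev⟩ := hx
    refine ⟨P, hP, IsFractionRing.injective S (FractionRing S) ?_⟩
    rw [Polynomial.hom_eval₂, hs, ← hφ, ← Polynomial.hom_eval₂, hev, map_zero, map_zero]
  obtain ⟨r, hr⟩ := (isIntegrallyClosedIn_iff.mp ‹IsIntegrallyClosedIn R S›).2 h2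
  refine ⟨r, φ.injective ?_⟩
  rw [← hs, ← hr]
  exact RingHom.congr_fun hφ r

theorem isIntegrallyClosed_dpdRing : IsIntegrallyClosed (dpdRing Dp Dm h) := by
  have := isIntegrallyClosed_laurentPolynomial (RatFunc ℂ)
  have : IsIntegrallyClosedIn (dpdRing Dp Dm h) (LaurentPolynomial (RatFunc ℂ)) :=
    Subring.isIntegrallyClosedIn_iff.mpr fun _ hx => mem_dpdRing_of_isIntegral h hx
  exact isIntegrallyClosed_of_isIntegrallyClosedIn _ (LaurentPolynomial (RatFunc ℂ))

end Normality

/-! ### Relations of the form `x ^ k y = G` -/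

/-- The elements `c tⁿ uᵃ` with pairwise different `(a, n)` are linearly independent. -/
theorem eq_zero_of_sum_single_zpow_eq_zero {ι : Type*} (s : Finset ι) (c : ι → ℂ) (a n : ι → ℤ)
    (hinj : Set.InjOn (fun v => (a v, n v)) s)
    (hsum : ∑ v ∈ s, (AddMonoidAlgebra.single (a v)
      (algebraMap ℂ (RatFunc ℂ) (c v) * RatFunc.X ^ n v) : LaurentPolynomial (RatFunc ℂ)) = 0) :
    ∀ v ∈ s, c v = 0 := by
  classical
  by_contra! hex
  obtain ⟨v₀, hv₀, hc₀⟩ := hex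
  -- Among the nonzero terms with the same power of `u` as `v₀`, the one with the least power of `t`
  -- has strictly smallest order at `0` and cannot cancel.
  obtain ⟨v, hv, hmin⟩ := (s.filter fun v => c v ≠ 0 ∧ a v = a v₀).exists_min_image n
    ⟨v₀, by simp [hv₀, hc₀]⟩
  simp only [Finset.mem_filter] at hv hmin
  obtain ⟨hvs, hcv, hav⟩ := hv
  have hX : (RatFunc.X : RatFunc ℂ) ≠ 0 := RatFunc.X_ne_zero
  have hCne : ∀ {z : ℂ}, z ≠ 0 → algebraMap ℂ (RatFunc ℂ) z ≠ 0 := fun hz => by simpa using hz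
  have hord : ∀ w, c w ≠ 0 →
      ordAt (algebraMap ℂ (RatFunc ℂ) (c w) * RatFunc.X ^ n w) 0 = n w := by
    intro w hw
    rw [ordAt_mul (hCne hw) (zpow_ne_zero _ hX), ordAt_algebraMap, ordAt_zpow hX, ordAt_X_zero]
    ring
  have h1 := congrArg (fun b : LaurentPolynomial (RatFunc ℂ) => b.coeff (a v₀)) hsum
  simp only [AddMonoidAlgebra.coeff_sum, Finsupp.finsetSum_apply, AddMonoidAlgebra.coeff_single,
    AddMonoidAlgebra.coeff_zero, Finsupp.coe_zero, Pi.zero_apply] at h1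
  rw [← Finset.add_sum_erase s _ hvs] at h1
  have h2 := sum_eq_zero_or_lt_ordAt (s.erase v) (fun w => (Finsupp.single (a w)
    (algebraMap ℂ (RatFunc ℂ) (c w) * RatFunc.X ^ n w)) (a v₀)) 0 (n v) (by
      intro w hw
      obtain ⟨hwv, hws⟩ := Finset.mem_erase.mp hw
      by_cases haw : a w = a v₀
      · by_cases hcw : c w = 0
        · exact Or.inl (by simp [hcw])
        · refine Or.inr ?_
          rw [haw, Finsupp.single_eq_same, hord w hcw]
          refine lt_of_le_of_ne (hmin w ⟨hws, hcw, haw⟩) fun he => hwv ?_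
          exact hinj hws hvs (Prod.ext (haw.trans hav.symm) he.symm)
      · exact Or.inl (Finsupp.single_eq_of_ne (Ne.symm haw)))
  have hne : (algebraMap ℂ (RatFunc ℂ) (c v) * RatFunc.X ^ n v) ≠ 0 :=
    mul_ne_zero (hCne hcv) (zpow_ne_zero _ hX)
  rw [eq_neg_of_add_eq_zero_right h1, hav, Finsupp.single_eq_same] at h2
  have h3 := h2.resolve_left (neg_ne_zero.mpr hne)
  rw [← neg_one_mul, ordAt_mul (by simp) hne, hord v hcv,
    show (-1 : RatFunc ℂ) = algebraMap ℂ (RatFunc ℂ) (-1) by simp, ordAt_algebraMap] at h3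
  omega

section Relation

variable {σ M : Type*} [AddCommMonoid M] {w : σ → M} {x y : σ} {k : ℕ} {G : MvPolynomial σ ℂ}

theorem apply_eq_zero_of_mem_supported_compl {g : MvPolynomial σ ℂ}
    (hg : g ∈ MvPolynomial.supported ℂ ({y}ᶜ : Set σ)) {v : σ →₀ ℕ} (hv : v ∈ g.support) :
    v y = 0 := by
  by_contra hne
  have := MvPolynomial.mem_supported.mp hg
    ((MvPolynomial.mem_vars_iff_mem_support y).mpr ⟨v, hv, Finsupp.mem_support_iff.mpr hne⟩)
  simp at this

/-- Modulo `x ^ k y - G`, a weighted homogeneous polynomial becomes free of `y` after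
multiplication by a power of `x`. -/
theorem exists_dvd_X_pow_mul_sub (hxy : x ≠ y)
    (hG : G ∈ MvPolynomial.supported ℂ ({y}ᶜ : Set σ))
    (hGw : MvPolynomial.IsWeightedHomogeneous w G (k • w x + w y))
    {f : MvPolynomial σ ℂ} {D : M} (hf : MvPolynomial.IsWeightedHomogeneous w f D) :
    ∃ (m : ℕ) (g : MvPolynomial σ ℂ), MvPolynomial.IsWeightedHomogeneous w g (m • w x + D) ∧
      g ∈ MvPolynomial.supported ℂ ({y}ᶜ : Set σ) ∧
      MvPolynomial.X x ^ k * MvPolynomial.X y - G ∣ MvPolynomial.X x ^ m * f - g := by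
  classical
  set K := f.support.sup fun v => v y
  have hK : ∀ v ∈ f.support, v y ≤ K := fun v hv => Finset.le_sup (f := fun v => v y) hv
  -- With `K` the degree of `f` in `y`, the factor `x ^ (k K)` supplies an `x ^ k` for each `y`, and
  -- each product `x ^ k y` is replaced by `G`. The error is divisible by `x ^ k y - G` because `A -
  -- B` divides `A ^ n - B ^ n`.
  refine ⟨k * K, ∑ v ∈ f.support, MvPolynomial.X x ^ (k * (K - v y)) * G ^ v y *
    MvPolynomial.monomial (v.erase y) (f.coeff v), ?_, ?_, ?_⟩
  · refine MvPolynomial.IsWeightedHomogeneous.sum _ _ _ fun v hv => ?_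
    have hv' : Finsupp.weight w v = D := hf (MvPolynomial.mem_support_iff.mp hv)
    have h1 := (((MvPolynomial.isWeightedHomogeneous_X ℂ w x).pow (k * (K - v y))).mul
      (hGw.pow (v y))).mul (MvPolynomial.isWeightedHomogeneous_monomial w (v.erase y)
        (f.coeff v) rfl)
    convert! h1 using 1
    have h2 : Finsupp.weight w v = v y • w y + Finsupp.weight w (v.erase y) := by
      conv_lhs => rw [← Finsupp.single_add_erase y v]
      rw [map_add, Finsupp.weight_single]
    rw [← hv', h2, smul_add, smul_smul, mul_comm (v y) k, ← add_assoc, ← add_assoc, ← add_smul,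
      ← mul_add, Nat.sub_add_cancel (hK v hv)]
  · refine Subalgebra.sum_mem _ fun v _ => Subalgebra.mul_mem _ (Subalgebra.mul_mem _
      (Subalgebra.pow_mem _ (MvPolynomial.X_mem_supported.mpr ?_) _)
      (Subalgebra.pow_mem _ hG _)) ?_
    · simpa using hxy
    · rw [MvPolynomial.mem_supported]
      intro j hj
      obtain ⟨u, hu, hju⟩ := (MvPolynomial.mem_vars_iff_mem_support j).mp hj
      rw [Finset.mem_singleton.mp (MvPolynomial.support_monomial_subset hu)] at hju
      rw [Finsupp.support_erase, Finset.mem_erase] at hju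
      simpa using hju.1
  · conv_rhs => enter [1, 2]; rw [MvPolynomial.as_sum f]
    rw [Finset.mul_sum, ← Finset.sum_sub_distrib]
    refine Finset.dvd_sum fun v hv => ?_
    have h1 : MvPolynomial.monomial v (f.coeff v) = MvPolynomial.X y ^ v y *
        MvPolynomial.monomial (v.erase y) (f.coeff v) := by
      rw [MvPolynomial.X_pow_eq_monomial, MvPolynomial.monomial_mul, one_mul,
        Finsupp.single_add_erase]
    have h2 : MvPolynomial.X x ^ (k * K) * (MvPolynomial.X y ^ v y *
          MvPolynomial.monomial (v.erase y) (f.coeff v)) -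
        MvPolynomial.X x ^ (k * (K - v y)) * G ^ v y *
          MvPolynomial.monomial (v.erase y) (f.coeff v) =
        ((MvPolynomial.X x ^ k * MvPolynomial.X y) ^ v y - G ^ v y) *
        (MvPolynomial.X x ^ (k * (K - v y)) *
          MvPolynomial.monomial (v.erase y) (f.coeff v)) := by
      have h3 : k * K = k * (K - v y) + k * v y := by
        rw [← mul_add, Nat.sub_add_cancel (hK v hv)]
      rw [h3, pow_add, pow_mul _ k (v y)]
      ring
    rw [h1, h2]
    exact Dvd.dvd.mul_right (sub_dvd_pow_sub_pow _ _ _) _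

/-- As `x` is prime and does not divide `F`, powers of `x` are relatively prime to `F` and can be
cancelled. This undoes the multiplication in `exists_dvd_X_pow_mul_sub`. -/
theorem dvd_of_dvd_X_pow_mul {F f : MvPolynomial σ ℂ} (hF : ¬ MvPolynomial.X x ∣ F) {m : ℕ}
    (h : F ∣ MvPolynomial.X x ^ m * f) : F ∣ f := by
  have hp : Irreducible (MvPolynomial.X x : MvPolynomial σ ℂ) :=
    (MvPolynomial.X_prime).irreducible
  exact ((hp.isRelPrime_iff_not_dvd.mpr hF).symm.pow_right (n := m)).dvd_of_dvd_mul_left h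

/-- Suppose that a homomorphism `Φ` kills `x ^ k y - G` and is injective on the weighted homogeneous
polynomials free of `y`. Then `x ^ k y - G` divides every weighted homogeneous polynomial in
the kernel. -/
theorem dvd_of_map_eq_zero {L : Type*} [CommRing L] (Φ : MvPolynomial σ ℂ →+* L) (hxy : x ≠ y)
    (hG : G ∈ MvPolynomial.supported ℂ ({y}ᶜ : Set σ))
    (hGw : MvPolynomial.IsWeightedHomogeneous w G (k • w x + w y))
    (hx : ¬ MvPolynomial.X x ∣ MvPolynomial.X x ^ k * MvPolynomial.X y - G)
    (hΦ : Φ (MvPolynomial.X x ^ k * MvPolynomial.X y - G) = 0)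
    (hinj : ∀ (g : MvPolynomial σ ℂ) (D : M), MvPolynomial.IsWeightedHomogeneous w g D →
      g ∈ MvPolynomial.supported ℂ ({y}ᶜ : Set σ) → Φ g = 0 → g = 0)
    {f : MvPolynomial σ ℂ} {D : M} (hf : MvPolynomial.IsWeightedHomogeneous w f D)
    (hf0 : Φ f = 0) :
    MvPolynomial.X x ^ k * MvPolynomial.X y - G ∣ f := by
  obtain ⟨m, g, hgw, hgs, q, hq⟩ := exists_dvd_X_pow_mul_sub hxy hG hGw hf
  have h1 : Φ g = 0 := by
    have := congrArg Φ hq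
    rw [map_sub, map_mul, hf0, mul_zero, map_mul, hΦ, zero_mul, zero_sub, neg_eq_zero] at this
    exact this
  rw [hinj g _ hgw hgs h1, sub_zero] at hq
  exact dvd_of_dvd_X_pow_mul hx ⟨q, hq⟩

end Relation

/-- A homomorphism to `ℂ(t)[u, u⁻¹]` is injective on polynomials whose monomials are mapped to
pairwise different elements `tⁿ uᵃ`. -/
theorem eq_zero_of_map_monomial {σ : Type*} {g : MvPolynomial σ ℂ}
    (Φ : MvPolynomial σ ℂ →ₐ[ℂ] LaurentPolynomial (RatFunc ℂ)) (a n : (σ →₀ ℕ) → ℤ)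
    (hΦ : ∀ v ∈ g.support, ∀ c : ℂ, Φ (MvPolynomial.monomial v c) = AddMonoidAlgebra.single (a v)
      (algebraMap ℂ (RatFunc ℂ) c * RatFunc.X ^ n v))
    (hinj : Set.InjOn (fun v => (a v, n v)) (g.support : Set (σ →₀ ℕ))) (hg : Φ g = 0) :
    g = 0 := by
  rw [MvPolynomial.as_sum g, map_sum, Finset.sum_congr rfl fun v hv => hΦ v hv _] at hg
  have h := eq_zero_of_sum_single_zpow_eq_zero g.support g.coeff a n hinj hg
  ext v
  by_contra hne
  exact hne (by simpa using h v (MvPolynomial.mem_support_iff.mpr hne))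

/-! ### Monomial description of `ℂ[t][D₊, D₋]` -/

/-- The divisors `D₊ = -(e₊/d) [0]` and `D₋ = -(e₋/d) [0] - (1/k) div Q`, with `Q(0) ≠ 0`,
in one of the two cases `k = 1` or `e₊ + e₋ = 0` with `div Q` reduced. -/
structure IsPresentation (d k eP : ℕ) (eM : ℤ) (Q : ℂ[X]) (Dp Dm : ℂ →₀ ℚ) : Prop where
  d_pos : 0 < d
  k_pos : 0 < k
  ne_zero : Q ≠ 0
  rootMultiplicity_zero : Q.rootMultiplicity 0 = 0
  add_nonneg : 0 ≤ (eP : ℤ) + eM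
  plus_zero : Dp 0 = -((eP : ℚ) / d)
  plus_of_ne : ∀ p, p ≠ 0 → Dp p = 0
  minus_zero : Dm 0 = -((eM : ℚ) / d)
  minus_of_ne : ∀ p, p ≠ 0 → Dm p = -((Q.rootMultiplicity p : ℚ) / k)
  cases : k = 1 ∨ ((eP : ℤ) + eM = 0 ∧ ∀ p, Q.rootMultiplicity p ≤ 1)

theorem single_mem_dpdRing {Dp Dm : ℂ →₀ ℚ} (h : Dp + Dm ≤ 0) {i : ℤ} {g : RatFunc ℂ}
    (hg : g ∈ sections (degreeDivisor Dp Dm i)) :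
    (AddMonoidAlgebra.single i g : LaurentPolynomial (RatFunc ℂ)) ∈ dpdRing Dp Dm h := by
  intro j
  rw [AddMonoidAlgebra.coeff_single]
  by_cases hj : j = i
  · subst hj
    rwa [Finsupp.single_eq_same]
  · rw [Finsupp.single_eq_of_ne hj]
    exact Submodule.zero_mem _

theorem mem_of_single_mem {T : AddSubmonoid (LaurentPolynomial (RatFunc ℂ))} {Dp Dm : ℂ →₀ ℚ}
    (h : Dp + Dm ≤ 0)
    (hT : ∀ i, ∀ g ∈ sections (degreeDivisor Dp Dm i), AddMonoidAlgebra.single i g ∈ T)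
    {a : LaurentPolynomial (RatFunc ℂ)} (ha : a ∈ dpdRing Dp Dm h) : a ∈ T := by
  rw [← AddMonoidAlgebra.sum_coeff_single a]
  exact T.sum_mem fun i _ => hT i _ (ha i)

theorem ordAt_pow_mul_zpow {Q : ℂ[X]} (hQ : Q ≠ 0) (b : ℕ) (j : ℤ) (p : ℂ) :
    ordAt (algebraMap ℂ[X] (RatFunc ℂ) Q ^ b * RatFunc.X ^ j) p =
      b * Q.rootMultiplicity p + j * ordAt RatFunc.X p := by
  have hQ' : algebraMap ℂ[X] (RatFunc ℂ) Q ≠ 0 := by simpa using hQ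
  rw [ordAt_mul (pow_ne_zero _ hQ') (zpow_ne_zero _ RatFunc.X_ne_zero), ordAt_pow hQ',
    ordAt_zpow RatFunc.X_ne_zero, ordAt_polynomial]

namespace IsPresentation

variable {d k eP : ℕ} {eM : ℤ} {Q : ℂ[X]} {Dp Dm : ℂ →₀ ℚ}

/-- At `0` the bound follows from `e₊ a + k e₋ b = (a - k b) e₊ + k b (e₊ + e₋) = (k b - a) e₋ + a
(e₊ + e₋)` and `e₊ + e₋ ≥ 0`. At `p ≠ 0` it follows from `(k b - a) / k ≤ b`. -/
theorem monomial_mem_sections (H : IsPresentation d k eP eM Q Dp Dm) (c : ℂ) {a b : ℕ} {j : ℤ}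
    (hle : (eP : ℤ) * a + k * eM * b ≤ d * j) :
    algebraMap ℂ (RatFunc ℂ) c * (algebraMap ℂ[X] (RatFunc ℂ) Q ^ b * RatFunc.X ^ j) ∈
      sections (degreeDivisor Dp Dm (a - k * b)) := by
  rw [← Algebra.smul_def]
  refine Submodule.smul_mem _ _ (Or.inr fun p => ?_)
  have hd : (0 : ℚ) < d := by exact_mod_cast H.d_pos
  have hk : (0 : ℚ) < k := by exact_mod_cast H.k_pos
  have hle' : (eP : ℚ) * a + k * eM * b ≤ d * j := by exact_mod_cast hle
  have hm : (0 : ℚ) ≤ eP + eM := by exact_mod_cast H.add_nonneg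
  have ha : (0 : ℚ) ≤ a := a.cast_nonneg
  have hb : (0 : ℚ) ≤ b := b.cast_nonneg
  rw [ordAt_pow_mul_zpow H.ne_zero]
  unfold degreeDivisor
  by_cases hp : p = 0
  · subst hp
    rw [H.rootMultiplicity_zero, ordAt_X_zero]
    split_ifs with hi
    · have h1 : ((a : ℚ) - k * b) * eP / d ≤ j := by
        rw [div_le_iff₀ hd]
        nlinarith [mul_nonneg (mul_nonneg hk.le hb) hm]
      rw [Finsupp.smul_apply, H.plus_zero, smul_eq_mul]
      push_cast
      rw [mul_neg, ← mul_div_assoc]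
      linarith
    · have h1 : ((k : ℚ) * b - a) * eM / d ≤ j := by
        rw [div_le_iff₀ hd]
        nlinarith [mul_nonneg ha hm]
      rw [Finsupp.smul_apply, H.minus_zero, smul_eq_mul]
      push_cast
      rw [mul_neg, ← mul_div_assoc, neg_sub]
      linarith
  · have hr : (0 : ℚ) ≤ Q.rootMultiplicity p := Nat.cast_nonneg _
    rw [ordAt_X_of_ne hp]
    split_ifs with hi
    · rw [Finsupp.smul_apply, H.plus_of_ne p hp, smul_zero]
      push_cast
      nlinarith
    · have h1 : ((k : ℚ) * b - a) * Q.rootMultiplicity p / k ≤ b * Q.rootMultiplicity p := by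
        rw [div_le_iff₀ hk]
        nlinarith [mul_nonneg ha hr]
      rw [Finsupp.smul_apply, H.minus_of_ne p hp, smul_eq_mul]
      push_cast
      rw [mul_neg, ← mul_div_assoc, neg_sub]
      linarith

/-- The converse of `monomial_mem_sections`, and the place where the two cases are needed. In degree
`i ≥ 0` take `b = 0`; in degree `-n` take the least possible `b = ⌈n / k⌉` and `a = k b - n`. -/
theorem exists_eq_of_mem_sections (H : IsPresentation d k eP eM Q Dp Dm) {i : ℤ} {g : RatFunc ℂ}
    (hg0 : g ≠ 0) (hg : g ∈ sections (degreeDivisor Dp Dm i)) :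
    ∃ (a b : ℕ) (j : ℤ) (q : ℂ[X]), i = a - k * b ∧ (eP : ℤ) * a + k * eM * b ≤ d * j ∧
      g = algebraMap ℂ[X] (RatFunc ℂ) Q ^ b * RatFunc.X ^ j * algebraMap ℂ[X] (RatFunc ℂ) q := by
  have hg := hg.resolve_left hg0
  have hd : (0 : ℚ) < d := by exact_mod_cast H.d_pos
  have hk : (0 : ℚ) < k := by exact_mod_cast H.k_pos
  have hk' := H.k_pos
  have hQ' : algebraMap ℂ[X] (RatFunc ℂ) Q ≠ 0 := by simpa using H.ne_zero
  -- Dividing `g` by `Q ^ b t ^ (ord₀ g)` then leaves a function without poles, that is, a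
  -- polynomial.
  suffices hs : ∃ a b : ℕ, i = a - k * b ∧ (eP : ℤ) * a + k * eM * b ≤ d * ordAt g 0 ∧
      ∀ p, p ≠ 0 → (b : ℤ) * Q.rootMultiplicity p ≤ ordAt g p by
    obtain ⟨a, b, hi, hle, hp⟩ := hs
    obtain ⟨q, hq⟩ := exists_eq_mul_polynomial (h := algebraMap ℂ[X] (RatFunc ℂ) Q ^ b *
      RatFunc.X ^ ordAt g 0) hg0 (mul_ne_zero (pow_ne_zero _ hQ')
        (zpow_ne_zero _ RatFunc.X_ne_zero)) fun p => by
      rw [ordAt_pow_mul_zpow H.ne_zero]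
      by_cases hp0 : p = 0
      · subst hp0
        rw [H.rootMultiplicity_zero, ordAt_X_zero]
        simp
      · rw [ordAt_X_of_ne hp0]
        simpa using hp p hp0
    exact ⟨a, b, _, q, hi, hle, hq⟩
  unfold degreeDivisor at hg
  split_ifs at hg with hi
  · lift i to ℕ using hi
    refine ⟨i, 0, by simp, ?_, fun p hp => ?_⟩
    · have h0 := hg 0
      rw [Finsupp.smul_apply, H.plus_zero, smul_eq_mul, mul_neg, ← mul_div_assoc,
        ← sub_eq_add_neg, sub_nonneg, div_le_iff₀ hd] at h0
      have h1 : (eP : ℚ) * i ≤ d * ordAt g 0 := by push_cast at h0; linarith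
      simpa using (by exact_mod_cast h1 : (eP : ℤ) * i ≤ d * ordAt g 0)
    · have h0 := hg p
      rw [Finsupp.smul_apply, H.plus_of_ne p hp, smul_zero, add_zero] at h0
      simpa using (by exact_mod_cast h0 : 0 ≤ ordAt g p)
  · obtain ⟨n, rfl⟩ : ∃ n : ℕ, i = -n := ⟨i.natAbs, by omega⟩
    have hb1 : n ≤ k * ((n + k - 1) / k) := by
      have h1 := Nat.div_add_mod (n + k - 1) k
      have h2 := Nat.mod_lt (n + k - 1) hk'
      omega
    -- The natural number division `(n + k - 1) / k` is `⌈n / k⌉`.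
    refine ⟨k * ((n + k - 1) / k) - n, (n + k - 1) / k, ?_, ?_, fun p hp => ?_⟩
    · rw [Nat.cast_sub hb1]
      push_cast
      ring
    · have h0 := hg 0
      rw [Finsupp.smul_apply, H.minus_zero, smul_eq_mul, mul_neg, ← mul_div_assoc,
        ← sub_eq_add_neg, sub_nonneg, div_le_iff₀ hd] at h0
      have h1 : (eM : ℚ) * n ≤ d * ordAt g 0 := by push_cast at h0; linarith
      have h2 : eM * n ≤ d * ordAt g 0 := by exact_mod_cast h1
      rw [Nat.cast_sub hb1]
      -- If `k = 1`, then `a = 0` and `b = n`. If `e₊ = -e₋`, then `e₊ (k b - n) + k e₋ b = e₋ n`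
      -- whatever `b` is.
      rcases H.cases with rfl | ⟨hm, -⟩
      · simpa using h2
      · have h3 : (eP : ℤ) = -eM := by omega
        rw [h3]
        push_cast
        linarith
    · have h0 := hg p
      rw [Finsupp.smul_apply, H.minus_of_ne p hp, smul_eq_mul, mul_neg, ← mul_div_assoc,
        ← sub_eq_add_neg, sub_nonneg, div_le_iff₀ hk] at h0
      have h1 : (n : ℤ) * Q.rootMultiplicity p ≤ ordAt g p * k := by
        push_cast at h0
        rw [neg_neg] at h0
        exact_mod_cast h0
      -- At a simple root, the order is an integer that is at least `n / k`, hence at least `⌈n /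
      -- k⌉`. A higher multiplicity would not survive this rounding in general.
      rcases H.cases with rfl | ⟨-, hr⟩
      · simpa using h1
      · have hk'' : (0 : ℤ) < k := by exact_mod_cast hk'
        rcases Nat.le_one_iff_eq_zero_or_eq_one.mp (hr p) with h2 | h2
        · rw [h2] at h1 ⊢
          simp only [Nat.cast_zero, mul_zero] at h1 ⊢
          exact nonneg_of_mul_nonneg_left h1 hk''
        · rw [h2] at h1 ⊢
          simp only [Nat.cast_one, mul_one] at h1 ⊢
          have h3 : 0 ≤ ordAt g p := by
            refine nonneg_of_mul_nonneg_left (le_trans (Int.natCast_nonneg n) h1) hk''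
          lift ordAt g p to ℕ using h3 with o
          norm_cast at h1 ⊢
          refine Nat.lt_succ_iff.mp ((Nat.div_lt_iff_lt_mul hk').mpr ?_)
          rw [Nat.succ_mul]
          omega

end IsPresentation

/-! ### The chart `z ≠ 0` -/

/-- The summand `s ^ (k (e₊ + e₋)) Q(s ^ d / z) z ^ (deg Q + α)` of `surfacePoly`. -/
noncomputable def surfaceRest (d k eP : ℕ) (eM : ℤ) (Q : ℂ[X]) (α : ℕ) : Poly4 :=
  MvPolynomial.X 3 ^ (k * ((eP : ℤ) + eM).toNat) *
    ∑ j ∈ Finset.range (Q.natDegree + 1),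
      MvPolynomial.C (Q.coeff j) * MvPolynomial.X 3 ^ (d * j) *
        MvPolynomial.X 2 ^ (Q.natDegree + α - j)

theorem surfacePoly_eq (d k eP : ℕ) (eM : ℤ) (Q : ℂ[X]) (α : ℕ) :
    surfacePoly d k eP eM Q α =
      MvPolynomial.X 0 ^ k * MvPolynomial.X 1 - surfaceRest d k eP eM Q α := rfl

theorem surfaceRest_mem_supported (d k eP : ℕ) (eM : ℤ) (Q : ℂ[X]) (α : ℕ) :
    surfaceRest d k eP eM Q α ∈ MvPolynomial.supported ℂ ({1}ᶜ : Set (Fin 4)) := by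
  have h3 : (MvPolynomial.X 3 : Poly4) ∈ MvPolynomial.supported ℂ ({1}ᶜ : Set (Fin 4)) :=
    MvPolynomial.X_mem_supported.mpr (by simp)
  have h2 : (MvPolynomial.X 2 : Poly4) ∈ MvPolynomial.supported ℂ ({1}ᶜ : Set (Fin 4)) :=
    MvPolynomial.X_mem_supported.mpr (by simp)
  exact Subalgebra.mul_mem _ (Subalgebra.pow_mem _ h3 _) (Subalgebra.sum_mem _ fun j _ =>
    Subalgebra.mul_mem _ (Subalgebra.mul_mem _ (Subalgebra.algebraMap_mem _ _)
      (Subalgebra.pow_mem _ h3 _)) (Subalgebra.pow_mem _ h2 _))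

/-- The weights of `x, y, z, s`. -/
def intWeights (d k eP : ℕ) (eM : ℤ) (N : ℤ) : Fin 4 → ℤ := ![(eP : ℤ), k * eM + d * N, d, 1]

theorem weight_intWeights (d k eP : ℕ) (eM : ℤ) (N : ℤ) (v : Fin 4 →₀ ℕ) :
    Finsupp.weight (intWeights d k eP eM N) v =
      v 0 * eP + v 1 * (k * eM + d * N) + v 2 * d + v 3 := by
  rw [Finsupp.weight_apply, Finsupp.sum_fintype _ _ (by simp), Fin.sum_univ_four]
  simp [intWeights]

theorem isWeightedHomogeneous_surfaceRest {d k eP : ℕ} {eM : ℤ} (hm : 0 ≤ (eP : ℤ) + eM)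
    (Q : ℂ[X]) (α : ℕ) :
    MvPolynomial.IsWeightedHomogeneous (intWeights d k eP eM (Q.natDegree + α))
      (surfaceRest d k eP eM Q α) (k * (eP + eM) + d * (Q.natDegree + α)) := by
  set w := intWeights d k eP eM (Q.natDegree + α)
  have h3 := MvPolynomial.isWeightedHomogeneous_X ℂ w 3
  have h2 := MvPolynomial.isWeightedHomogeneous_X ℂ w 2
  refine MvPolynomial.IsWeightedHomogeneous.mul (m := (k * (eP + eM) : ℤ)) ?_
    (MvPolynomial.IsWeightedHomogeneous.sum _ _ _ fun j hj => ?_)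
  · convert! h3.pow (k * ((eP : ℤ) + eM).toNat) using 1
    simp [w, intWeights, hm]
  · convert! ((MvPolynomial.isWeightedHomogeneous_C w (Q.coeff j)).mul (h3.pow (d * j))).mul
      (h2.pow (Q.natDegree + α - j)) using 1
    have hj' := Finset.mem_range.mp hj
    simp only [w, intWeights, nsmul_eq_mul, Matrix.cons_val]
    rw [Nat.cast_sub (by omega)]
    push_cast
    ring

theorem isWeightedHomogeneous_surfacePoly {d k eP : ℕ} {eM : ℤ} (hm : 0 ≤ (eP : ℤ) + eM)
    (Q : ℂ[X]) (α : ℕ) :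
    MvPolynomial.IsWeightedHomogeneous (intWeights d k eP eM (Q.natDegree + α))
      (surfacePoly d k eP eM Q α) (k * (eP + eM) + d * (Q.natDegree + α)) := by
  rw [surfacePoly_eq]
  refine Submodule.sub_mem (MvPolynomial.weightedHomogeneousSubmodule ℂ _ _) ?_
    (isWeightedHomogeneous_surfaceRest hm Q α)
  set w := intWeights d k eP eM (Q.natDegree + α)
  have h := ((MvPolynomial.isWeightedHomogeneous_X ℂ w 0).pow k).mul
    (MvPolynomial.isWeightedHomogeneous_X ℂ w 1)
  rw [MvPolynomial.mem_weightedHomogeneousSubmodule]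
  convert! h using 1
  simp only [w, intWeights, nsmul_eq_mul, Matrix.cons_val]
  ring

/-- Lets one argument serve both gradings: over `ℤ`, where the weight of `y` may be negative, and
over `ℕ`, where `Proj` is available. -/
theorem isWeightedHomogeneous_comp_iff {σ M N : Type*} [AddCommMonoid M] [AddCommMonoid N]
    (ι : M →+ N) (hι : Function.Injective ι) (w : σ → M) (f : MvPolynomial σ ℂ) (D : M) :
    MvPolynomial.IsWeightedHomogeneous (ι ∘ w) f (ι D) ↔
      MvPolynomial.IsWeightedHomogeneous w f D := by
  have h : ∀ v : σ →₀ ℕ, Finsupp.weight (ι ∘ w) v = ι (Finsupp.weight w v) := fun v => by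
    simp [Finsupp.weight_apply, map_finsuppSum]
  simp only [MvPolynomial.IsWeightedHomogeneous, h, hι.eq_iff]

/-- The homomorphism `x ↦ u, y ↦ Q(t) t ^ (-N) u ^ (-k), z ↦ t⁻¹, s ↦ 1`. -/
noncomputable def chartPolyHom (k : ℕ) (Q : ℂ[X]) (N : ℕ) :
    Poly4 →ₐ[ℂ] LaurentPolynomial (RatFunc ℂ) :=
  MvPolynomial.aeval ![AddMonoidAlgebra.single 1 1,
    AddMonoidAlgebra.single (-(k : ℤ))
      (algebraMap ℂ[X] (RatFunc ℂ) Q * RatFunc.X ^ (-(N : ℤ))),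
    AddMonoidAlgebra.single 0 RatFunc.X⁻¹, 1]

theorem chartPolyHom_monomial (k : ℕ) (Q : ℂ[X]) (N : ℕ) (v : Fin 4 →₀ ℕ) (c : ℂ) :
    chartPolyHom k Q N (MvPolynomial.monomial v c) =
      AddMonoidAlgebra.single ((v 0 : ℤ) - k * v 1) (algebraMap ℂ (RatFunc ℂ) c *
        (algebraMap ℂ[X] (RatFunc ℂ) Q ^ v 1 * RatFunc.X ^ (-((N : ℤ) * v 1) - v 2))) := by
  rw [chartPolyHom, MvPolynomial.aeval_monomial, Finsupp.prod_fintype _ _ (by simp),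
    Fin.prod_univ_four]
  simp only [Matrix.cons_val, AddMonoidAlgebra.single_pow, one_pow, mul_one,
    AddMonoidAlgebra.single_mul_single, AddMonoidAlgebra.coe_algebraMap, Function.comp_apply,
    one_mul]
  congr 1
  · simp
    ring
  · rw [mul_pow, sub_eq_add_neg, zpow_add₀ RatFunc.X_ne_zero, inv_pow, zpow_neg _ (v 2 : ℤ),
      zpow_natCast, ← neg_mul, zpow_mul, zpow_natCast, mul_assoc]

theorem chartPolyHom_surfacePoly (d k eP : ℕ) (eM : ℤ) (Q : ℂ[X]) (α : ℕ) :
    chartPolyHom k Q (Q.natDegree + α) (surfacePoly d k eP eM Q α) = 0 := by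
  rw [surfacePoly_eq, map_sub, sub_eq_zero]
  have h0 : chartPolyHom k Q (Q.natDegree + α) (MvPolynomial.X 0) =
      AddMonoidAlgebra.single 1 1 := by simp [chartPolyHom]
  have h1 : chartPolyHom k Q (Q.natDegree + α) (MvPolynomial.X 1) =
      AddMonoidAlgebra.single (-(k : ℤ)) (algebraMap ℂ[X] (RatFunc ℂ) Q *
        RatFunc.X ^ (-((Q.natDegree + α : ℕ) : ℤ))) := by simp [chartPolyHom]
  have h2 : chartPolyHom k Q (Q.natDegree + α) (MvPolynomial.X 2) =
      AddMonoidAlgebra.single 0 RatFunc.X⁻¹ := by simp [chartPolyHom]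
  have h3 : chartPolyHom k Q (Q.natDegree + α) (MvPolynomial.X 3) = 1 := by simp [chartPolyHom]
  have hC : ∀ c : ℂ, chartPolyHom k Q (Q.natDegree + α) (MvPolynomial.C c) =
      AddMonoidAlgebra.single 0 (algebraMap ℂ (RatFunc ℂ) c) := fun c =>
    (chartPolyHom k Q (Q.natDegree + α)).commutes c
  rw [surfaceRest]
  simp only [map_mul, map_pow, map_sum, h0, h1, h2, h3, hC, one_pow, one_mul, mul_one,
    AddMonoidAlgebra.single_pow, AddMonoidAlgebra.single_mul_single, nsmul_zero, add_zero]
  rw [show k • (1 : ℤ) + -(k : ℤ) = 0 by simp]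
  have hQ : algebraMap ℂ[X] (RatFunc ℂ) Q = ∑ j ∈ Finset.range (Q.natDegree + 1),
      algebraMap ℂ (RatFunc ℂ) (Q.coeff j) * RatFunc.X ^ j := by
    conv_lhs => rw [Polynomial.as_sum_range_C_mul_X_pow Q]
    simp only [map_sum, map_mul, map_pow, RatFunc.algebraMap_C, RatFunc.algebraMap_X]
    rfl
  rw [hQ, Finset.sum_mul]
  change AddMonoidAlgebra.singleAddHom 0 _ = ∑ j ∈ _, AddMonoidAlgebra.singleAddHom 0 _
  rw [map_sum]
  refine Finset.sum_congr rfl fun j hj => ?_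
  have hj' := Finset.mem_range.mp hj
  congr 1
  rw [mul_assoc, ← zpow_natCast, ← zpow_add₀ RatFunc.X_ne_zero, inv_pow, ← zpow_natCast,
    ← zpow_neg, Nat.cast_sub (by omega)]
  congr 2
  ring

theorem sum_C_mul_X_pow_mul (Q : ℂ[X]) (d : ℕ) :
    ∑ j ∈ Finset.range (Q.natDegree + 1), Polynomial.C (Q.coeff j) * Polynomial.X ^ (d * j) =
      Polynomial.expand ℂ d Q := by
  conv_rhs => rw [Polynomial.as_sum_range_C_mul_X_pow Q]
  simp [pow_mul]

theorem not_X_dvd_surfacePoly {d : ℕ} (hd : 0 < d) (k eP : ℕ) (eM : ℤ) {Q : ℂ[X]}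
    (hQ : Q ≠ 0) (α : ℕ) : ¬ MvPolynomial.X 0 ∣ surfacePoly d k eP eM Q α := by
  intro hdvd
  -- Setting `x = y = 0` and `z = 1` kills multiples of `x`, but turns `F` into a nonzero polynomial
  -- in `s`.
  set θ : Poly4 →ₐ[ℂ] ℂ[X] := MvPolynomial.aeval ![0, 0, 1, Polynomial.X]
  have hC : ∀ c : ℂ, θ (MvPolynomial.C c) = Polynomial.C c := fun c => θ.commutes c
  have h1 : θ (surfacePoly d k eP eM Q α) =
      -(Polynomial.X ^ (k * ((eP : ℤ) + eM).toNat) * Polynomial.expand ℂ d Q) := by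
    rw [← sum_C_mul_X_pow_mul, surfacePoly]
    simp only [map_sub, map_mul, map_pow, map_sum, hC]
    simp [θ]
  have h2 : θ (surfacePoly d k eP eM Q α) = 0 := by
    have h3 := map_dvd θ hdvd
    rw [show θ (MvPolynomial.X 0) = 0 by simp [θ]] at h3
    exact zero_dvd_iff.mp h3
  rw [h1, neg_eq_zero] at h2
  exact mul_ne_zero (pow_ne_zero _ Polynomial.X_ne_zero)
    ((Polynomial.expand_ne_zero hd).mpr hQ) h2

/-- Homogeneity is essential, since `s - 1` is in the kernel. Once `y` is eliminated, the image of a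
monomial shows its exponents of `x` and `z`, and the fixed degree recovers that of `s`. -/
theorem surfacePoly_dvd_of_chartPolyHom_eq_zero {d k eP : ℕ} {eM : ℤ} (hd : 0 < d)
    (hm : 0 ≤ (eP : ℤ) + eM) {Q : ℂ[X]} (hQ : Q ≠ 0) {α : ℕ} {f : Poly4} {D : ℤ}
    (hf : MvPolynomial.IsWeightedHomogeneous (intWeights d k eP eM (Q.natDegree + α)) f D)
    (hf0 : chartPolyHom k Q (Q.natDegree + α) f = 0) :
    surfacePoly d k eP eM Q α ∣ f := by
  rw [surfacePoly_eq]
  refine dvd_of_map_eq_zero (w := intWeights d k eP eM (Q.natDegree + α))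
    (chartPolyHom k Q (Q.natDegree + α)).toRingHom (by decide)
    (surfaceRest_mem_supported d k eP eM Q α) ?_ (not_X_dvd_surfacePoly hd k eP eM hQ α)
    (chartPolyHom_surfacePoly d k eP eM Q α) ?_ hf hf0
  · convert! isWeightedHomogeneous_surfaceRest hm Q α using 1
    simp only [intWeights, nsmul_eq_mul, Matrix.cons_val]
    ring
  · intro g D hg hgs hg0
    have hy : ∀ v ∈ g.support, v 1 = 0 := fun v hv => apply_eq_zero_of_mem_supported_compl hgs hv
    refine eq_zero_of_map_monomial (chartPolyHom k Q (Q.natDegree + α)) (fun v => v 0)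
      (fun v => -(v 2 : ℤ)) (fun v hv c => ?_) (fun v hv v' hv' he => ?_) hg0
    · rw [chartPolyHom_monomial, hy v hv]
      simp
    · have h1 := hg (MvPolynomial.mem_support_iff.mp hv)
      have h2 := hg (MvPolynomial.mem_support_iff.mp hv')
      rw [weight_intWeights, hy v hv] at h1
      rw [weight_intWeights, hy v' hv'] at h2
      simp only [Prod.mk.injEq, neg_inj, Nat.cast_inj] at he
      rw [he.1, he.2] at h1
      ext i
      fin_cases i
      · exact he.1
      · exact (hy v hv).trans (hy v' hv').symm
      · exact he.2
      · have : (v 3 : ℤ) = v' 3 := by linarith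
        exact_mod_cast this

theorem zClass_mem {M : Type} [AddCommMonoid M] {w : Fin 4 → M} {F : Poly4} {n : M}
    (hF : MvPolynomial.IsWeightedHomogeneous w F n) : zClass F ∈ hypGrading w F hF (w 2) :=
  mk_mem_hypGrading w F hF (MvPolynomial.isWeightedHomogeneous_X ℂ w 2)

section Chart

variable {M : Type} [AddCommMonoid M] {w : Fin 4 → M}
  {d k eP : ℕ} {eM : ℤ} {Q : ℂ[X]} {α : ℕ} {n : M}
  (hF : MvPolynomial.IsWeightedHomogeneous w (surfacePoly d k eP eM Q α) n)

/-- The homomorphism `ℂ[x, y, z, s] / (F) → ℂ(t)[u, u⁻¹]` induced by `chartPolyHom`. -/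
noncomputable def chartQuotientHom (d k eP : ℕ) (eM : ℤ) (Q : ℂ[X]) (α : ℕ) :
    (Poly4 ⧸ Ideal.span {surfacePoly d k eP eM Q α}) →+* LaurentPolynomial (RatFunc ℂ) :=
  Ideal.Quotient.lift _ (chartPolyHom k Q (Q.natDegree + α)).toRingHom (by
    change Ideal.span _ ≤ RingHom.ker (chartPolyHom k Q (Q.natDegree + α)).toRingHom
    rw [Ideal.span_singleton_le_iff_mem, RingHom.mem_ker]
    exact chartPolyHom_surfacePoly d k eP eM Q α)

theorem chartQuotientHom_mk (f : Poly4) :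
    chartQuotientHom d k eP eM Q α (Ideal.Quotient.mk _ f) =
      chartPolyHom k Q (Q.natDegree + α) f := rfl

theorem chartQuotientHom_zClass :
    chartQuotientHom d k eP eM Q α (zClass _) = AddMonoidAlgebra.single 0 RatFunc.X⁻¹ := by
  rw [zClass, chartQuotientHom_mk]
  simp [chartPolyHom]

theorem single_zero_mul_single_zero_inv {r : RatFunc ℂ} (hr : r ≠ 0) :
    (AddMonoidAlgebra.single 0 r : LaurentPolynomial (RatFunc ℂ)) *
      AddMonoidAlgebra.single 0 r⁻¹ = 1 := by
  rw [AddMonoidAlgebra.single_mul_single, mul_inv_cancel₀ hr, add_zero, AddMonoidAlgebra.one_def]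

theorem isUnit_chartQuotientHom_zClass :
    IsUnit (chartQuotientHom d k eP eM Q α (zClass _)) := by
  rw [chartQuotientHom_zClass]
  exact IsUnit.of_mul_eq_one _ ((mul_comm _ _).trans <| single_zero_mul_single_zero_inv RatFunc.X_ne_zero)

variable [DecidableEq M]

/-- The homomorphism `(R[1/z])₀ → ℂ(t)[u, u⁻¹]` induced by `chartPolyHom`. -/
noncomputable def chartHom : ChartRing w _ hF →+* LaurentPolynomial (RatFunc ℂ) :=
  (IsLocalization.Away.lift (S := Localization.Away (zClass (surfacePoly d k eP eM Q α))) _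
    (isUnit_chartQuotientHom_zClass (d := d) (k := k) (eP := eP) (eM := eM) (Q := Q)
      (α := α))).comp
    (algebraMap (ChartRing w _ hF)
      (Localization.Away (zClass (surfacePoly d k eP eM Q α))))

theorem chartHom_mk (r : ℕ) (f : Poly4)
    (hf : Ideal.Quotient.mk _ f ∈ hypGrading w (surfacePoly d k eP eM Q α) hF (r • w 2)) :
    chartHom hF (HomogeneousLocalization.Away.mk _ (zClass_mem hF) r
      (Ideal.Quotient.mk _ f) hf) =
      chartPolyHom k Q (Q.natDegree + α) f * AddMonoidAlgebra.single 0 (RatFunc.X ^ r) := by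
  rw [chartHom, RingHom.comp_apply, HomogeneousLocalization.algebraMap_apply,
    HomogeneousLocalization.Away.val_mk, Localization.mk_eq_mk', IsLocalization.Away.lift,
    IsLocalization.lift_mk'_spec, map_pow, chartQuotientHom_zClass, chartQuotientHom_mk,
    mul_left_comm, mul_comm _ (AddMonoidAlgebra.single 0 (RatFunc.X ^ r)),
    AddMonoidAlgebra.single_pow, nsmul_zero, inv_pow,
    single_zero_mul_single_zero_inv (pow_ne_zero _ RatFunc.X_ne_zero), mul_one]

theorem exists_eq_away_mk (a : ChartRing w _ hF) :
    ∃ (r : ℕ) (f : Poly4) (hf : MvPolynomial.IsWeightedHomogeneous w f (r • w 2)),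
      a = HomogeneousLocalization.Away.mk _ (zClass_mem hF) r (Ideal.Quotient.mk _ f)
        (mk_mem_hypGrading w _ hF hf) := by
  obtain ⟨r, b, hb, rfl⟩ := HomogeneousLocalization.Away.mk_surjective _ (zClass_mem hF) a
  obtain ⟨f, hf, rfl⟩ := hb
  exact ⟨r, f, hf, rfl⟩

theorem chartHom_injective (ι : M →+ ℤ) (hι : Function.Injective ι)
    (hw : ι ∘ w = intWeights d k eP eM (Q.natDegree + α)) (hd : 0 < d)
    (hm : 0 ≤ (eP : ℤ) + eM) (hQ : Q ≠ 0) :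
    Function.Injective (chartHom hF) := by
  rw [injective_iff_map_eq_zero]
  intro a ha
  obtain ⟨r, f, hf, rfl⟩ := exists_eq_away_mk hF a
  rw [chartHom_mk] at ha
  have h1 : chartPolyHom k Q (Q.natDegree + α) f = 0 := by
    have h2 := congrArg (· * AddMonoidAlgebra.single (0 : ℤ) ((RatFunc.X ^ r)⁻¹ : RatFunc ℂ)) ha
    simpa only [mul_assoc, single_zero_mul_single_zero_inv (pow_ne_zero r RatFunc.X_ne_zero),
      mul_one, zero_mul] using h2
  rw [← isWeightedHomogeneous_comp_iff ι hι, hw] at hf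
  have h2 := surfacePoly_dvd_of_chartPolyHom_eq_zero hd hm hQ hf h1
  apply HomogeneousLocalization.val_injective
  rw [HomogeneousLocalization.Away.val_mk, HomogeneousLocalization.val_zero,
    Ideal.Quotient.eq_zero_iff_mem.mpr (Ideal.mem_span_singleton.mpr h2), Localization.mk_zero]

/-- In degree zero, the nonnegative exponent of `s` is the slack in the inequality of
`monomial_mem_sections`. -/
theorem chartHom_mem_dpdRing (ι : M →+ ℤ) (hι : Function.Injective ι)
    (hw : ι ∘ w = intWeights d k eP eM (Q.natDegree + α))
    {Dp Dm : ℂ →₀ ℚ} (hD : Dp + Dm ≤ 0) (H : IsPresentation d k eP eM Q Dp Dm) (a : ChartRing w _ hF) :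
    chartHom hF a ∈ dpdRing Dp Dm hD := by
  obtain ⟨r, f, hf, rfl⟩ := exists_eq_away_mk hF a
  rw [← isWeightedHomogeneous_comp_iff ι hι, hw] at hf
  rw [chartHom_mk, MvPolynomial.as_sum f, map_sum, Finset.sum_mul]
  refine Subalgebra.sum_mem _ fun v hv => ?_
  rw [chartPolyHom_monomial, AddMonoidAlgebra.single_mul_single, add_zero, mul_assoc, mul_assoc,
    ← zpow_natCast RatFunc.X r, ← zpow_add₀ RatFunc.X_ne_zero]
  refine single_mem_dpdRing hD (H.monomial_mem_sections _ ?_)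
  have h1 := hf (MvPolynomial.mem_support_iff.mp hv)
  rw [weight_intWeights, map_nsmul, show ι (w 2) = d from congrFun hw 2, nsmul_eq_mul] at h1
  have h2 : (0 : ℤ) ≤ v 3 := Int.natCast_nonneg _
  push_cast
  linarith

theorem mem_range_chartHom (ι : M →+ ℤ) (hι : Function.Injective ι)
    (hw : ι ∘ w = intWeights d k eP eM (Q.natDegree + α))
    {Dp Dm : ℂ →₀ ℚ} (hD : Dp + Dm ≤ 0) (H : IsPresentation d k eP eM Q Dp Dm)
    {b : LaurentPolynomial (RatFunc ℂ)} (hb : b ∈ dpdRing Dp Dm hD) :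
    b ∈ (chartHom hF).range := by
  refine mem_of_single_mem (T := (chartHom hF).range.toAddSubgroup.toAddSubmonoid) hD
    (fun i g hg => ?_) hb
  change _ ∈ (chartHom hF).range
  by_cases hg0 : g = 0
  · rw [hg0, AddMonoidAlgebra.single_zero]
    exact Subring.zero_mem _
  obtain ⟨a, b, j, q, rfl, hle, rfl⟩ := H.exists_eq_of_mem_sections hg0 hg
  rw [Polynomial.as_sum_range_C_mul_X_pow q, map_sum, Finset.mul_sum]
  change AddMonoidAlgebra.singleAddHom _ _ ∈ _
  rw [map_sum]
  refine Subring.sum_mem _ fun i _ => ?_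
  set N := Q.natDegree + α with hN
  -- The power of `t = 1 / z` that remains to be produced may have either sign: its positive part
  -- goes into the denominator `z ^ r`, its negative part into the numerator `z ^ e`.
  obtain ⟨r, e, hre⟩ : ∃ r e : ℕ, (r : ℤ) - e = N * b + (j + i) := by
    refine ⟨((N : ℤ) * b + (j + i)).toNat, (-((N : ℤ) * b + (j + i))).toNat, ?_⟩
    omega
  -- The slack in the inequality becomes the exponent of `s` and makes the degree zero.
  obtain ⟨c, hc⟩ : ∃ c : ℕ, (c : ℤ) = d * (j + i) - (eP * a + k * eM * b) := by
    refine ⟨(d * (j + i) - (eP * a + k * eM * b) : ℤ).toNat, Int.toNat_of_nonneg ?_⟩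
    have : (0 : ℤ) ≤ d * i := by positivity
    linarith
  set v : Fin 4 →₀ ℕ := Finsupp.equivFunOnFinite.symm ![a, b, e, c] with hv
  have h0 : v 0 = a := rfl
  have h1 : v 1 = b := rfl
  have h2 : v 2 = e := rfl
  have h3 : v 3 = c := rfl
  have hwt : MvPolynomial.IsWeightedHomogeneous w (MvPolynomial.monomial v (q.coeff i))
      (r • w 2) := by
    rw [← isWeightedHomogeneous_comp_iff ι hι, hw]
    refine MvPolynomial.isWeightedHomogeneous_monomial _ _ _ ?_
    rw [weight_intWeights, map_nsmul, show ι (w 2) = d from congrFun hw 2, nsmul_eq_mul, h0, h1,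
      h2, h3, hc]
    have h4 : (r : ℤ) = e + (N * b + (j + i)) := by linarith
    rw [h4, hN]
    push_cast
    ring
  refine ⟨HomogeneousLocalization.Away.mk _ (zClass_mem hF) r _ (mk_mem_hypGrading w _ hF hwt), ?_⟩
  rw [chartHom_mk, chartPolyHom_monomial, AddMonoidAlgebra.single_mul_single, add_zero, h0, h1, h2]
  change AddMonoidAlgebra.single _ _ = AddMonoidAlgebra.single _ _
  congr 1
  rw [map_mul, map_pow, RatFunc.algebraMap_X, RatFunc.algebraMap_C,
    show RatFunc.C (q.coeff i) = algebraMap ℂ (RatFunc ℂ) (q.coeff i) from rfl]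
  have hX : (RatFunc.X : RatFunc ℂ) ^ (-((N : ℤ) * b) - e) * RatFunc.X ^ r =
      RatFunc.X ^ j * RatFunc.X ^ i := by
    rw [← zpow_natCast, ← zpow_natCast, ← zpow_add₀ RatFunc.X_ne_zero,
      ← zpow_add₀ RatFunc.X_ne_zero]
    congr 1
    linarith
  rw [mul_assoc, mul_assoc, hX]
  ring

theorem chartHom_smul (c : ℂ) (a : ChartRing w _ hF) :
    chartHom hF (c • a) = c • chartHom hF a := by
  obtain ⟨r, f, hf, rfl⟩ := exists_eq_away_mk hF a
  have h1 : c • HomogeneousLocalization.Away.mk (hypGrading w _ hF) (zClass_mem hF) r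
      (Ideal.Quotient.mk _ f) (mk_mem_hypGrading w _ hF hf) =
      HomogeneousLocalization.Away.mk _ (zClass_mem hF) r (Ideal.Quotient.mk _ (c • f))
        (mk_mem_hypGrading w _ hF (Submodule.smul_mem _ c hf)) := rfl
  rw [h1, chartHom_mk, chartHom_mk, map_smul, smul_mul_assoc]

theorem chartPolyHom_torusScale (k : ℕ) (Q : ℂ[X]) (N : ℕ) (l : ℂˣ) (f : Poly4) :
    chartPolyHom k Q N (torusScale k l f) = laurentScale l (chartPolyHom k Q N f) := by
  have h : (chartPolyHom k Q N).comp (torusScale k l) =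
      ((laurentScale l).restrictScalars ℂ).comp (chartPolyHom k Q N) := by
    have hs : ∀ (i : ℤ) (g : RatFunc ℂ), laurentScale l (AddMonoidAlgebra.single i g) =
        ((l ^ i : ℂˣ) : ℂ) • AddMonoidAlgebra.single i g := by
      intro i g
      ext j
      rw [coeff_laurentScale, AddMonoidAlgebra.coeff_smul_apply, AddMonoidAlgebra.coeff_single]
      by_cases hj : j = i
      · rw [hj]
      · rw [Finsupp.single_eq_of_ne hj, smul_zero, smul_zero]
    have hC : ∀ c : ℂ, chartPolyHom k Q N (MvPolynomial.C c) = algebraMap ℂ _ c := fun c =>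
      (chartPolyHom k Q N).commutes c
    have hX : ∀ i, chartPolyHom k Q N (MvPolynomial.X i) = _ := MvPolynomial.aeval_X _
    refine MvPolynomial.algHom_ext fun i => ?_
    rw [AlgHom.comp_apply, AlgHom.comp_apply, AlgHom.restrictScalars_apply, torusScale, scale,
      MvPolynomial.aeval_X, map_mul, hC, ← Algebra.smul_def, hX]
    fin_cases i
    · change (l : ℂ) • AddMonoidAlgebra.single 1 1 = laurentScale l (AddMonoidAlgebra.single 1 1)
      rw [hs, zpow_one]
    · exact (hs _ _).symm
    · change (1 : ℂ) • AddMonoidAlgebra.single 0 _ = laurentScale l (AddMonoidAlgebra.single 0 _)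
      rw [hs, zpow_zero, Units.val_one]
    · change (1 : ℂ) • (1 : LaurentPolynomial (RatFunc ℂ)) = laurentScale l 1
      rw [map_one, one_smul]
  exact DFunLike.congr_fun h f

theorem chartHom_chartTorus (l : ℂˣ) (a : ChartRing w _ hF) :
    chartHom hF (chartTorus w _ hF k (torusScale_surfacePoly d k eP eM Q α) l a) =
      laurentScale l (chartHom hF a) := by
  obtain ⟨r, f, hf, rfl⟩ := exists_eq_away_mk hF a
  have hf' : Ideal.Quotient.mk _ (torusScale k l f) ∈
      hypGrading w (surfacePoly d k eP eM Q α) hF (r • w 2) :=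
    (hypTorus w _ hF k (torusScale_surfacePoly d k eP eM Q α) l).map_mem
      (mk_mem_hypGrading w _ hF hf)
  have h1 : chartTorus w _ hF k (torusScale_surfacePoly d k eP eM Q α) l
      (HomogeneousLocalization.Away.mk _ (zClass_mem hF) r (Ideal.Quotient.mk _ f)
        (mk_mem_hypGrading w _ hF hf)) =
      HomogeneousLocalization.Away.mk _ (zClass_mem hF) r
        (Ideal.Quotient.mk _ (torusScale k l f)) hf' := by
    rw [chartTorus, HomogeneousLocalization.Away.mk, HomogeneousLocalization.map_mk]
    apply HomogeneousLocalization.val_injective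
    rw [HomogeneousLocalization.val_mk, HomogeneousLocalization.Away.val_mk]
    congr 1
    refine Subtype.ext ?_
    change hypTorus w _ hF k (torusScale_surfacePoly d k eP eM Q α) l (zClass _ ^ r) = zClass _ ^ r
    rw [map_pow, hypTorus_zClass]
  rw [h1, chartHom_mk, chartHom_mk, map_mul, chartPolyHom_torusScale]
  congr 1
  ext j
  rw [coeff_laurentScale, AddMonoidAlgebra.coeff_single]
  by_cases hj : j = 0
  · rw [hj, zpow_zero, Units.val_one, one_smul]
  · rw [Finsupp.single_eq_of_ne hj, smul_zero]

/-- The equivariant isomorphism `ℂ[t][D₊, D₋] ≅ (R[1/z])₀`. -/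
theorem exists_dpdRing_equiv_chartRing (ι : M →+ ℤ) (hι : Function.Injective ι)
    (hw : ι ∘ w = intWeights d k eP eM (Q.natDegree + α))
    {Dp Dm : ℂ →₀ ℚ} (hD : Dp + Dm ≤ 0) (H : IsPresentation d k eP eM Q Dp Dm) :
    ∃ ψ : dpdRing Dp Dm hD ≃+* ChartRing w _ hF,
      (∀ (c : ℂ) (a : dpdRing Dp Dm hD), ψ (c • a) = c • ψ a) ∧
      ∀ (l : ℂˣ) (a : dpdRing Dp Dm hD), ψ (dpdTorus Dp Dm hD l a) =
        chartTorus w _ hF k (torusScale_surfacePoly d k eP eM Q α) l (ψ a) := by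
  have hinj := chartHom_injective hF ι hι hw H.d_pos H.add_nonneg H.ne_zero
  set φ : ChartRing w _ hF →+* dpdRing Dp Dm hD :=
    (chartHom hF).codRestrict _ (chartHom_mem_dpdRing hF ι hι hw hD H)
  have hφ : Function.Bijective φ := by
    refine ⟨fun a b hab => hinj (congrArg Subtype.val hab), fun b => ?_⟩
    obtain ⟨a, ha⟩ := mem_range_chartHom hF ι hι hw hD H b.2
    exact ⟨a, Subtype.ext ha⟩
  set e := RingEquiv.ofBijective φ hφ
  have he : ∀ a, (e a : LaurentPolynomial (RatFunc ℂ)) = chartHom hF a := fun a => rfl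
  refine ⟨e.symm, fun c a => ?_, fun l a => ?_⟩
  · obtain ⟨b, rfl⟩ := e.surjective a
    rw [RingEquiv.symm_apply_apply, RingEquiv.symm_apply_eq]
    refine Subtype.ext ?_
    rw [he, chartHom_smul, Subalgebra.coe_smul, he]
  · obtain ⟨b, rfl⟩ := e.surjective a
    rw [RingEquiv.symm_apply_apply, RingEquiv.symm_apply_eq]
    refine Subtype.ext ?_
    rw [he, chartHom_chartTorus]
    rfl

end Chart

/-! ### The affine hypersurface `x ^ k y = s ^ (k m) Q(s)` -/

section Affine

variable (k m : ℕ) (Q : ℂ[X])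

/-- The polynomial `s ^ (k m) Q(s)` in `ℂ[x, y, s]`. -/
noncomputable def affineRest : MvPolynomial (Fin 3) ℂ :=
  Polynomial.aeval (MvPolynomial.X 2) (Polynomial.X ^ (k * m) * Q)

/-- The homomorphism `x ↦ u, y ↦ t ^ (k m) Q(t) u ^ (-k), s ↦ t`. -/
noncomputable def affineHom : MvPolynomial (Fin 3) ℂ →ₐ[ℂ] LaurentPolynomial (RatFunc ℂ) :=
  MvPolynomial.aeval ![AddMonoidAlgebra.single 1 1,
    AddMonoidAlgebra.single (-(k : ℤ))
      (algebraMap ℂ[X] (RatFunc ℂ) (Polynomial.X ^ (k * m) * Q)),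
    AddMonoidAlgebra.single 0 RatFunc.X]

theorem affineHom_monomial (v : Fin 3 →₀ ℕ) (c : ℂ) :
    affineHom k m Q (MvPolynomial.monomial v c) =
      AddMonoidAlgebra.single ((v 0 : ℤ) - k * v 1) (algebraMap ℂ (RatFunc ℂ) c *
        (algebraMap ℂ[X] (RatFunc ℂ) Q ^ v 1 *
          RatFunc.X ^ ((k * m * v 1 + v 2 : ℕ) : ℤ))) := by
  rw [affineHom, MvPolynomial.aeval_monomial, Finsupp.prod_fintype _ _ (by simp),
    Fin.prod_univ_three]
  simp only [Matrix.cons_val, AddMonoidAlgebra.single_pow, one_pow,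
    AddMonoidAlgebra.single_mul_single, AddMonoidAlgebra.coe_algebraMap, Function.comp_apply,
    one_mul]
  congr 1
  · simp
    ring
  · rw [map_mul, map_pow, RatFunc.algebraMap_X, zpow_natCast, pow_add, pow_mul, mul_pow]
    ring

theorem affineHom_affineRest :
    affineHom k m Q (affineRest k m Q) =
      AddMonoidAlgebra.single 0 (algebraMap ℂ[X] (RatFunc ℂ) (Polynomial.X ^ (k * m) * Q)) := by
  rw [affineRest, ← Polynomial.aeval_algHom_apply]
  set P := Polynomial.X ^ (k * m) * Q
  have h2 : affineHom k m Q (MvPolynomial.X 2) = AddMonoidAlgebra.single 0 RatFunc.X := by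
    simp [affineHom]
  have h : Polynomial.aeval (AddMonoidAlgebra.single 0 RatFunc.X : LaurentPolynomial (RatFunc ℂ)) =
      (AddMonoidAlgebra.singleZeroAlgHom (R := RatFunc ℂ) (M := ℤ) |>.restrictScalars ℂ).comp
        (Algebra.algHom ℂ ℂ[X] (RatFunc ℂ)) := by
    refine Polynomial.algHom_ext ?_
    rw [Polynomial.aeval_X]
    change AddMonoidAlgebra.single 0 _ = AddMonoidAlgebra.single 0 (algebraMap ℂ[X] (RatFunc ℂ) _)
    rw [RatFunc.algebraMap_X]
  rw [h2, h]
  rfl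

theorem affineHom_relation :
    affineHom k m Q (MvPolynomial.X 0 ^ k * MvPolynomial.X 1 - affineRest k m Q) = 0 := by
  have h0 : affineHom k m Q (MvPolynomial.X 0) = AddMonoidAlgebra.single 1 1 := by
    simp [affineHom]
  have h1 : affineHom k m Q (MvPolynomial.X 1) = AddMonoidAlgebra.single (-(k : ℤ))
      (algebraMap ℂ[X] (RatFunc ℂ) (Polynomial.X ^ (k * m) * Q)) :=
    MvPolynomial.aeval_X _ _
  rw [map_sub, affineHom_affineRest, map_mul, map_pow, h0, h1, AddMonoidAlgebra.single_pow,
    AddMonoidAlgebra.single_mul_single, one_pow, one_mul,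
    show k • (1 : ℤ) + -(k : ℤ) = 0 by simp, sub_self]

variable {k m Q}

theorem dvd_of_affineHom_eq_zero (hQ : Q ≠ 0) {f : MvPolynomial (Fin 3) ℂ}
    (hf : affineHom k m Q f = 0) :
    MvPolynomial.X 0 ^ k * MvPolynomial.X 1 - affineRest k m Q ∣ f := by
  -- Here `s ↦ t` loses no exponent, so no grading is needed; with weights `0` every polynomial is
  -- homogeneous.
  have hwt : ∀ g : MvPolynomial (Fin 3) ℂ,
      MvPolynomial.IsWeightedHomogeneous (0 : Fin 3 → ℕ) g 0 := fun g v _ => by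
    simp [Finsupp.weight_apply]
  refine dvd_of_map_eq_zero (w := (0 : Fin 3 → ℕ)) (affineHom k m Q).toRingHom (by decide) ?_
    (by simpa using hwt _) ?_ (affineHom_relation k m Q) ?_ (hwt f) hf
  · have h : (Polynomial.aeval (MvPolynomial.X 2 : MvPolynomial (Fin 3) ℂ)
        (Polynomial.X ^ (k * m) * Q)) ∈ MvPolynomial.supported ℂ ({1}ᶜ : Set (Fin 3)) :=
      (Algebra.adjoin_le (Set.singleton_subset_iff.mpr
        (MvPolynomial.X_mem_supported.mpr (by simp)))) (Polynomial.aeval_mem_adjoin_singleton ℂ _)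
    exact h
  · intro hdvd
    set θ : MvPolynomial (Fin 3) ℂ →ₐ[ℂ] ℂ[X] := MvPolynomial.aeval ![0, 0, Polynomial.X]
    have h1 : θ (MvPolynomial.X 0 ^ k * MvPolynomial.X 1 - affineRest k m Q) =
        -(Polynomial.X ^ (k * m) * Q) := by
      rw [affineRest, map_sub, ← Polynomial.aeval_algHom_apply]
      simp [θ]
    have h2 := map_dvd θ hdvd
    rw [show θ (MvPolynomial.X 0) = 0 by simp [θ], zero_dvd_iff, h1, neg_eq_zero] at h2
    exact mul_ne_zero (pow_ne_zero _ Polynomial.X_ne_zero) hQ h2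
  · intro g D _ hgs hg0
    have hy : ∀ v ∈ g.support, v 1 = 0 := fun v hv => apply_eq_zero_of_mem_supported_compl hgs hv
    refine eq_zero_of_map_monomial (affineHom k m Q) (fun v => v 0)
      (fun v => v 2) (fun v hv c => ?_) (fun v hv v' hv' he => ?_) hg0
    · rw [affineHom_monomial, hy v hv]
      simp
    · simp only [Prod.mk.injEq, Nat.cast_inj] at he
      ext i
      fin_cases i
      · exact he.1
      · exact (hy v hv).trans (hy v' hv').symm
      · exact he.2

/-- The affine surface belongs to the presentation with `d = 1`, `e₊ = 0`, `e₋ = m`, for which the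
slack is again the exponent of `s`. -/
theorem affineHom_mem_dpdRing {Dp Dm : ℂ →₀ ℚ} (hD : Dp + Dm ≤ 0)
    (H : IsPresentation 1 k 0 m Q Dp Dm) (f : MvPolynomial (Fin 3) ℂ) :
    affineHom k m Q f ∈ dpdRing Dp Dm hD := by
  rw [MvPolynomial.as_sum f, map_sum]
  refine Subalgebra.sum_mem _ fun v hv => ?_
  rw [affineHom_monomial]
  refine single_mem_dpdRing hD (H.monomial_mem_sections _ ?_)
  push_cast
  linarith [Int.natCast_nonneg (v 2)]

theorem mem_range_affineHom {Dp Dm : ℂ →₀ ℚ} (hD : Dp + Dm ≤ 0)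
    (H : IsPresentation 1 k 0 m Q Dp Dm) {b : LaurentPolynomial (RatFunc ℂ)}
    (hb : b ∈ dpdRing Dp Dm hD) : b ∈ (affineHom k m Q).range := by
  refine mem_of_single_mem (T := (affineHom k m Q).range.toSubmodule.toAddSubmonoid) hD
    (fun i g hg => ?_) hb
  change _ ∈ (affineHom k m Q).range
  by_cases hg0 : g = 0
  · rw [hg0, AddMonoidAlgebra.single_zero]
    exact Subalgebra.zero_mem _
  obtain ⟨a, b, j, q, rfl, hle, rfl⟩ := H.exists_eq_of_mem_sections hg0 hg
  rw [Polynomial.as_sum_range_C_mul_X_pow q, map_sum, Finset.mul_sum]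
  change AddMonoidAlgebra.singleAddHom _ _ ∈ _
  rw [map_sum]
  refine Subalgebra.sum_mem _ fun i _ => ?_
  obtain ⟨c, hc⟩ : ∃ c : ℕ, (c : ℤ) = j + i - k * m * b := by
    refine ⟨(j + i - k * m * b : ℤ).toNat, Int.toNat_of_nonneg ?_⟩
    push_cast at hle
    linarith [Int.natCast_nonneg i]
  set v : Fin 3 →₀ ℕ := Finsupp.equivFunOnFinite.symm ![a, b, c] with hv
  have h0 : v 0 = a := rfl
  have h1 : v 1 = b := rfl
  have h2 : v 2 = c := rfl
  refine ⟨MvPolynomial.monomial v (q.coeff i), ?_⟩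
  change affineHom k m Q _ = _
  rw [affineHom_monomial, h0, h1, h2]
  change AddMonoidAlgebra.single _ _ = AddMonoidAlgebra.single _ _
  congr 1
  rw [map_mul, map_pow, RatFunc.algebraMap_X, RatFunc.algebraMap_C,
    show RatFunc.C (q.coeff i) = algebraMap ℂ (RatFunc ℂ) (q.coeff i) from rfl]
  have hX : (RatFunc.X : RatFunc ℂ) ^ ((k * m * b + c : ℕ) : ℤ) =
      RatFunc.X ^ j * RatFunc.X ^ i := by
    rw [← zpow_natCast, ← zpow_add₀ RatFunc.X_ne_zero]
    congr 1
    push_cast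
    linarith
  rw [hX]
  ring

theorem nonempty_affineQuotient_equiv_dpdRing {Dp Dm : ℂ →₀ ℚ} (hD : Dp + Dm ≤ 0)
    (H : IsPresentation 1 k 0 m Q Dp Dm) :
    Nonempty ((MvPolynomial (Fin 3) ℂ ⧸
      Ideal.span {MvPolynomial.X 0 ^ k * MvPolynomial.X 1 - affineRest k m Q}) ≃+*
        dpdRing Dp Dm hD) := by
  set φ : MvPolynomial (Fin 3) ℂ →+* dpdRing Dp Dm hD :=
    (affineHom k m Q).toRingHom.codRestrict _ (affineHom_mem_dpdRing hD H)
  have hsurj : Function.Surjective φ := fun b => by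
    obtain ⟨a, ha⟩ := mem_range_affineHom hD H b.2
    exact ⟨a, Subtype.ext ha⟩
  have hker : Ideal.span {MvPolynomial.X 0 ^ k * MvPolynomial.X 1 - affineRest k m Q} =
      RingHom.ker φ := by
    refine le_antisymm ?_ fun f hf => ?_
    · rw [Ideal.span_singleton_le_iff_mem, RingHom.mem_ker]
      exact Subtype.ext (affineHom_relation k m Q)
    · exact Ideal.mem_span_singleton.mpr (dvd_of_affineHom_eq_zero H.ne_zero
        (congrArg Subtype.val (RingHom.mem_ker.mp hf)))
  exact ⟨(Ideal.quotEquivOfEq hker).trans (RingHom.quotientKerEquivOfSurjective hsurj)⟩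

/-- The affine surface `x ^ k y = s ^ (k m) Q(s)` is normal if `k = 1`, or if `m = 0` and `Q` has
simple roots only. -/
theorem isIntegrallyClosed_affineQuotient (hk : 0 < k) (hQ : Q ≠ 0)
    (hQ0 : Q.rootMultiplicity 0 = 0) (hcase : k = 1 ∨ (m = 0 ∧ ∀ p, Q.rootMultiplicity p ≤ 1)) :
    IsDomain (MvPolynomial (Fin 3) ℂ ⧸
      Ideal.span {MvPolynomial.X 0 ^ k * MvPolynomial.X 1 - affineRest k m Q}) ∧
    IsIntegrallyClosed (MvPolynomial (Fin 3) ℂ ⧸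
      Ideal.span {MvPolynomial.X 0 ^ k * MvPolynomial.X 1 - affineRest k m Q}) := by
  -- The divisor `D₋ = -m [0] - (1/k) div Q`, to be paired with `D₊ = 0`.
  obtain ⟨Dm, happ⟩ : ∃ Dm : ℂ →₀ ℚ, ∀ p, Dm p =
      (if p = 0 then -(m : ℚ) else 0) - Q.rootMultiplicity p / k := by
    refine ⟨Finsupp.single 0 (-(m : ℚ)) - (1 / (k : ℚ)) •
      (Multiset.toFinsupp Q.roots).mapRange (Nat.cast : ℕ → ℚ) Nat.cast_zero, fun p => ?_⟩
    by_cases hp : p = 0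
    · simp [hp, div_eq_inv_mul]
    · simp [hp, div_eq_inv_mul]
  have H : IsPresentation 1 k 0 m Q 0 Dm :=
    { d_pos := one_pos
      k_pos := hk
      ne_zero := hQ
      rootMultiplicity_zero := hQ0
      add_nonneg := by simp
      plus_zero := by simp
      plus_of_ne := by simp
      minus_zero := by simp [happ, hQ0]
      minus_of_ne := fun p hp => by simp [happ, hp]
      cases := hcase.imp_right fun h => ⟨by simp [h.1], h.2⟩ }
  have hD : 0 + Dm ≤ 0 := by
    intro p
    have h1 : (0 : ℚ) ≤ Q.rootMultiplicity p / k :=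
      div_nonneg (Nat.cast_nonneg _) (Nat.cast_nonneg _)
    have h2 : (0 : ℚ) ≤ m := Nat.cast_nonneg _
    have h3 : Dm p ≤ 0 := by
      rw [happ]
      split_ifs <;> linarith
    simpa using h3
  obtain ⟨e⟩ := nonempty_affineQuotient_equiv_dpdRing hD H
  have := isIntegrallyClosed_dpdRing hD
  exact ⟨e.toMulEquiv.isDomain _, IsIntegrallyClosed.of_equiv e.symm⟩

end Affine

/-! ### Setting `z = 1`: the passage from `Q(t)` to `Q(s ^ d)`. -/

theorem dehomogenize_surfacePoly (d k eP : ℕ) (eM : ℤ) (Q : ℂ[X]) (α : ℕ) :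
    dehomogenize (surfacePoly d k eP eM Q α) = MvPolynomial.X 0 ^ k * MvPolynomial.X 1 -
      affineRest k ((eP : ℤ) + eM).toNat (Polynomial.expand ℂ d Q) := by
  have hC : ∀ c : ℂ, dehomogenize (MvPolynomial.C c) = MvPolynomial.C c := fun c =>
    dehomogenize.commutes c
  rw [surfacePoly, affineRest, ← sum_C_mul_X_pow_mul]
  simp only [map_sub, map_mul, map_pow, map_sum, hC, Polynomial.aeval_X, Polynomial.aeval_C]
  simp [dehomogenize, MvPolynomial.algebraMap_eq]

theorem rootMultiplicity_expand_zero {d : ℕ} (hd : 0 < d) {Q : ℂ[X]} (hQ : Q ≠ 0)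
    (hQ0 : Q.rootMultiplicity 0 = 0) : (Polynomial.expand ℂ d Q).rootMultiplicity 0 = 0 := by
  refine Polynomial.rootMultiplicity_eq_zero fun h => ?_
  rw [Polynomial.IsRoot, Polynomial.expand_eval, zero_pow hd.ne'] at h
  exact ((Polynomial.rootMultiplicity_pos hQ).mpr h).ne' hQ0

/-- The derivative of `Q(s ^ d)` is `d s ^ (d - 1) Q'(s ^ d)`, so a multiple root `p ≠ 0` would make
`p ^ d` a multiple root of `Q`. The root `p = 0` is excluded by `Q(0) ≠ 0`. -/
theorem rootMultiplicity_expand_le_one {d : ℕ} (hd : 0 < d) {Q : ℂ[X]} (hQ : Q ≠ 0)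
    (hQ0 : Q.rootMultiplicity 0 = 0) (h1 : ∀ p, Q.rootMultiplicity p ≤ 1) (p : ℂ) :
    (Polynomial.expand ℂ d Q).rootMultiplicity p ≤ 1 := by
  by_contra! hlt
  obtain ⟨hr, hr'⟩ := (Polynomial.one_lt_rootMultiplicity_iff_isRoot
    ((Polynomial.expand_ne_zero hd).mpr hQ)).mp hlt
  have hp : p ≠ 0 := by
    rintro rfl
    rw [rootMultiplicity_expand_zero hd hQ hQ0] at hlt
    omega
  rw [Polynomial.IsRoot, Polynomial.expand_eval] at hr
  rw [Polynomial.IsRoot, Polynomial.derivative_expand, Polynomial.eval_mul,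
    Polynomial.expand_eval] at hr'
  have hne : Polynomial.eval p ((d : ℂ[X]) * Polynomial.X ^ (d - 1)) ≠ 0 := by
    simp [hd.ne', hp]
  have h2 := (mul_eq_zero.mp hr').resolve_right hne
  exact absurd (h1 (p ^ d)) (not_le.mpr
    ((Polynomial.one_lt_rootMultiplicity_iff_isRoot hQ).mpr ⟨hr, h2⟩))

/-! ### The open subscheme `D₊(z)` -/

/-- Stated with a separate `b = f a` so that it applies to the torus, which fixes the class of `z`
by a proved equality only. -/
theorem awayι_comp_projMap {A B σ τ : Type} [CommRing A] [SetLike σ A] [AddSubgroupClass σ A]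
    [CommRing B] [SetLike τ B] [AddSubgroupClass τ B] {𝒜 : ℕ → σ} {ℬ : ℕ → τ} [GradedRing 𝒜]
    [GradedRing ℬ] (f : GradedRingHom 𝒜 ℬ)
    (hf : HomogeneousIdeal.irrelevant ℬ ≤ (HomogeneousIdeal.irrelevant 𝒜).map f)
    {i : ℕ} (hi : 0 < i) {a : A} (ha : a ∈ 𝒜 i) {b : B} (hb : b ∈ ℬ i) (hab : f a = b)
    (hle : Submonoid.powers a ≤ (Submonoid.powers b).comap f) :
    Proj.awayι ℬ b hb hi ≫ Proj.map f hf =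
      Spec.map (CommRingCat.ofHom (HomogeneousLocalization.map f hle)) ≫
        Proj.awayι 𝒜 a ha hi := by
  subst hab
  exact Proj.awayι_comp_map f hf hi a ha

variable (w : Fin 4 → ℕ) (F : Poly4) {n : ℕ}
  (hF : MvPolynomial.IsWeightedHomogeneous w F n)

theorem X_two_mem_polyGrading : (MvPolynomial.X 2 : Poly4) ∈ polyGrading w (w 2) :=
  MvPolynomial.isWeightedHomogeneous_X ℂ w 2

/-- The points of `D₊(z)` in `V₊(F)` are the points of `ℙ(w)` in `D₊(z)` where `F` vanishes. -/
theorem image_hypInclusion_basicOpen (hz : 0 < w 2) :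
    hypInclusion w F hF '' (Proj.basicOpen (hypGrading w F hF) (zClass F) :
      Set (Hypersurface w F hF)) =
      (Proj.basicOpen (polyGrading w) (MvPolynomial.X 2) : Set (WeightedProj w)) ∩
        ProjectiveSpectrum.zeroLocus (polyGrading w) {F} := by
  ext p
  constructor
  · rintro ⟨q, hq, rfl⟩
    refine ⟨hq, Set.singleton_subset_iff.mpr ?_⟩
    change Ideal.Quotient.mk (Ideal.span {F}) F ∈ q.asHomogeneousIdeal.toIdeal
    rw [Ideal.Quotient.eq_zero_iff_mem.mpr (Ideal.mem_span_singleton_self F)]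
    exact Ideal.zero_mem _
  · rintro ⟨hpz, hpF⟩
    set π := Ideal.Quotient.mk (Ideal.span {F})
    have hpF' : F ∈ p.asHomogeneousIdeal.toIdeal :=
      Set.singleton_subset_iff.mp ((ProjectiveSpectrum.mem_zeroLocus _ _ _).mp hpF)
    have hker : RingHom.ker π ≤ p.asHomogeneousIdeal.toIdeal := by
      rw [Ideal.mk_ker, Ideal.span_singleton_le_iff_mem]
      exact hpF'
    -- A prime containing `F` is recovered from its image in the quotient, so this image is the
    -- point of `V₊(F)` over `p`.
    have hcomap : (p.asHomogeneousIdeal.toIdeal.map π).comap π = p.asHomogeneousIdeal.toIdeal := by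
      rw [Ideal.comap_map_of_surjective' π Ideal.Quotient.mk_surjective, sup_eq_left]
      exact hker
    have hzq : zClass F ∉ p.asHomogeneousIdeal.toIdeal.map π := fun h => by
      have h1 : MvPolynomial.X 2 ∈ (p.asHomogeneousIdeal.toIdeal.map π).comap π := h
      rw [hcomap] at h1
      exact hpz h1
    have hprime := p.isPrime
    let q : Hypersurface w F hF :=
      { asHomogeneousIdeal := p.asHomogeneousIdeal.map (hypQuotient w F hF)
        isPrime := Ideal.map_isPrime_of_surjective Ideal.Quotient.mk_surjective hker
        not_irrelevant_le := fun h => hzq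
          (h (HomogeneousIdeal.mem_irrelevant_of_mem _ hz (zClass_mem hF))) }
    refine ⟨q, hzq, ?_⟩
    exact ProjectiveSpectrum.ext (HomogeneousIdeal.ext hcomap)

/-- The homomorphism `(ℂ[x, y, z, s][1/z])₀ → (R[1/z])₀` is surjective. -/
theorem away_map_hypQuotient_surjective :
    Function.Surjective (HomogeneousLocalization.Away.map (hypQuotient w F hF)
      (MvPolynomial.X 2)) := by
  intro a
  obtain ⟨r, b, ⟨f, hf, rfl⟩, rfl⟩ :=
    HomogeneousLocalization.Away.mk_surjective _ (zClass_mem hF) a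
  exact ⟨HomogeneousLocalization.Away.mk _ (X_two_mem_polyGrading w) r f hf,
    HomogeneousLocalization.Away.map_mk _ _ _ _ _ _⟩

section Immersion

variable (hz : 0 < w 2) {A : Type} [CommRing A]
  (ψ : A ≃+* ChartRing w F hF)

/-- The morphism `Spec A ⟶ V₊(F)` given by an isomorphism `A ≅ (R[1/z])₀`. -/
noncomputable def toHypersurface : Spec (CommRingCat.of A) ⟶ Hypersurface w F hF :=
  Spec.map (RingEquiv.toCommRingCatIso ψ).inv ≫
    Proj.awayι (hypGrading w F hF) (zClass F) (zClass_mem hF) hz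

instance : IsOpenImmersion (toHypersurface w F hF hz ψ) := by
  unfold toHypersurface
  infer_instance

theorem range_toHypersurface :
    Set.range (toHypersurface w F hF hz ψ) =
      (Proj.basicOpen (hypGrading w F hF) (zClass F) : Set (Hypersurface w F hF)) := by
  have h := Proj.opensRange_awayι (hypGrading w F hF) (zClass F) (zClass_mem hF) hz
  rw [← h, ← Scheme.Hom.opensRange_comp_of_isIso (Spec.map (RingEquiv.toCommRingCatIso ψ).inv)]
  rfl

theorem toHypersurface_toSpec [Algebra ℂ A] (hψ : ∀ (c : ℂ) (a : A), ψ (c • a) = c • ψ a) :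
    toHypersurface w F hF hz ψ ≫ hypersurfaceToSpec w F hF =
      Spec.map (CommRingCat.ofHom (algebraMap ℂ A)) := by
  rw [toHypersurface, hypersurfaceToSpec, Category.assoc, Proj.awayι_toSpecZero_assoc,
    ← Spec.map_comp, ← Spec.map_comp]
  congr 1
  ext c
  change ψ.symm (HomogeneousLocalization.fromZeroRingHom _ _ (algebraMap ℂ _ c)) = algebraMap ℂ A c
  rw [RingEquiv.symm_apply_eq, Algebra.algebraMap_eq_smul_one (A := A), hψ, map_one]
  apply HomogeneousLocalization.val_injective
  rw [HomogeneousLocalization.val_smul, HomogeneousLocalization.val_one]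
  rw [Algebra.algebraMap_eq_smul_one]
  change Localization.mk (c • (1 : Poly4 ⧸ Ideal.span {F})) 1 = _
  rw [← Localization.smul_mk, Localization.mk_one]

theorem map_comp_toHypersurface (k : ℕ) (hinv : ∀ l : ℂˣ, torusScale k l F = F) (l : ℂˣ)
    (τ : A →+* A) (hτ : ∀ a, ψ (τ a) = chartTorus w F hF k hinv l (ψ a)) :
    Spec.map (CommRingCat.ofHom τ) ≫ toHypersurface w F hF hz ψ =
      toHypersurface w F hF hz ψ ≫ hypersurfaceTorus w F hF k hinv l := by
  rw [toHypersurface, hypersurfaceTorus, Category.assoc,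
    awayι_comp_projMap (hypTorus w F hF k hinv l) _ hz (zClass_mem hF)
      (zClass_mem hF) (hypTorus_zClass w F hF k hinv l) (by
        rw [Submonoid.powers_le]
        change hypTorus w F hF k hinv l (zClass F) ∈ Submonoid.powers (zClass F)
        rw [hypTorus_zClass]
        exact Submonoid.mem_powers _),
    ← Category.assoc, ← Category.assoc, ← Spec.map_comp, ← Spec.map_comp]
  congr 2
  ext a
  change τ (ψ.symm a) = ψ.symm (chartTorus w F hF k hinv l a)
  rw [RingEquiv.eq_symm_apply, hτ, RingEquiv.apply_symm_apply]

theorem toHypersurface_hypInclusion :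
    toHypersurface w F hF hz ψ ≫ hypInclusion w F hF =
      Spec.map (RingEquiv.toCommRingCatIso ψ).inv ≫
        Spec.map (CommRingCat.ofHom (HomogeneousLocalization.Away.map (hypQuotient w F hF)
          (MvPolynomial.X 2))) ≫
        Proj.awayι (polyGrading w) (MvPolynomial.X 2)
          (X_two_mem_polyGrading w) hz := by
  rw [toHypersurface, Category.assoc]
  congr 1
  exact Proj.awayι_comp_map (hypQuotient w F hF) _ hz (MvPolynomial.X 2)
    (X_two_mem_polyGrading w)

/-- Inside `ℙ(w)` the morphism is, up to an isomorphism, a closed immersion into the affine chart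
`D₊(z)`, given by a surjection of rings, followed by the open immersion of that chart. -/
theorem isImmersion_toHypersurface_hypInclusion :
    IsImmersion (toHypersurface w F hF hz ψ ≫ hypInclusion w F hF) := by
  have := IsClosedImmersion.spec_of_surjective (CommRingCat.ofHom
    (HomogeneousLocalization.Away.map (hypQuotient w F hF) (MvPolynomial.X 2)))
    (away_map_hypQuotient_surjective w F hF)
  rw [toHypersurface_hypInclusion]
  have h : IsImmersion (Spec.map (CommRingCat.ofHom (HomogeneousLocalization.Away.map
      (hypQuotient w F hF) (MvPolynomial.X 2))) ≫
        Proj.awayι (polyGrading w) (MvPolynomial.X 2) (X_two_mem_polyGrading w) hz) :=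
    inferInstance
  exact @IsImmersion.comp _ _ _ (Spec.map (RingEquiv.toCommRingCatIso ψ).inv) _ inferInstance h

theorem range_toHypersurface_hypInclusion :
    Set.range (toHypersurface w F hF hz ψ ≫ hypInclusion w F hF) =
      (Proj.basicOpen (polyGrading w) (MvPolynomial.X 2) : Set (WeightedProj w)) ∩
        ProjectiveSpectrum.zeroLocus (polyGrading w) {F} := by
  rw [← image_hypInclusion_basicOpen w F hF hz, ← range_toHypersurface w F hF hz ψ,
    ← Set.range_comp]
  rfl

end Immersion

/-! ### From the given divisors to the presentation, and the corollary. -/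

theorem IsPresentation.of_divisors {d k eP : ℕ} {eM : ℤ} {D₀ : ℂ →₀ ℤ} {Q : ℂ[X]}
    {Dp Dm : ℂ →₀ ℚ} (hD : Dp + Dm ≤ 0) (heP : 0 < eP) (hePd : eP ≤ d) (hk : 0 < k)
    (hDp : Dp = Finsupp.single 0 (-((eP : ℚ) / d)))
    (hDm : Dm = Finsupp.single 0 (-((eM : ℚ) / d)) -
      (1 / (k : ℚ)) • D₀.mapRange (Int.cast : ℤ → ℚ) Int.cast_zero)
    (hD₀ : D₀ 0 = 0)
    (hQ : Q ≠ 0) (hdiv : ∀ p : ℂ, D₀ p = ordAt (algebraMap ℂ[X] (RatFunc ℂ) Q) p)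
    (hcase : k = 1 ∨ ((eP : ℤ) + eM = 0 ∧ ∀ p : ℂ, D₀ p = 0 ∨ D₀ p = 1)) :
    IsPresentation d k eP eM Q Dp Dm := by
  have hroot : ∀ p, D₀ p = Q.rootMultiplicity p := fun p => by rw [hdiv, ordAt_polynomial]
  have hd : 0 < d := heP.trans_le hePd
  have hp0 : Dp 0 = -((eP : ℚ) / d) := by rw [hDp, Finsupp.single_eq_same]
  have hm0 : Dm 0 = -((eM : ℚ) / d) := by simp [hDm, hD₀]
  refine
    { d_pos := hd
      k_pos := hk
      ne_zero := hQ
      rootMultiplicity_zero := by exact_mod_cast (hroot 0).symm.trans hD₀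
      add_nonneg := ?_
      plus_zero := hp0
      plus_of_ne := fun p hp => by rw [hDp, Finsupp.single_eq_of_ne hp]
      minus_zero := hm0
      minus_of_ne := fun p hp => by simp [hDm, hp, hroot p, div_eq_inv_mul]
      cases := hcase.imp_right fun h => ⟨h.1, fun p => ?_⟩ }
  -- The inequality `e₊ + e₋ ≥ 0` is `D₊ + D₋ ≤ 0` read at the origin.
  · have h0 : Dp 0 + Dm 0 ≤ 0 := by simpa using hD 0
    have hd' : (0 : ℚ) < d := by exact_mod_cast hd
    rw [hp0, hm0, ← neg_add, ← add_div, neg_nonpos] at h0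
    have h1 := mul_nonneg h0 hd'.le
    rw [div_mul_cancel₀ _ hd'.ne'] at h1
    exact_mod_cast h1
  · have h1 := h.2 p
    rw [hroot p] at h1
    omega

end CStarSurface

theorem corollary2p5
    -- the data of the presentation
    (d k eP : ℕ) (eM : ℤ) (D₀ : ℂ →₀ ℤ) (Q : ℂ[X]) (Dp Dm : ℂ →₀ ℚ)
    (hD : Dp + Dm ≤ 0)
    (heP : 0 < eP) (hePd : eP ≤ d) (hk : 0 < k)
    (hDp : Dp = Finsupp.single 0 (-((eP : ℚ) / d)))
    (hDm : Dm = Finsupp.single 0 (-((eM : ℚ) / d)) -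
      (1 / (k : ℚ)) • D₀.mapRange (Int.cast : ℤ → ℚ) Int.cast_zero)
    (hD₀ : D₀ 0 = 0)
    (hQ : Q ≠ 0) (hdiv : ∀ p : ℂ, D₀ p = ordAt (algebraMap ℂ[X] (RatFunc ℂ) Q) p)
    -- the two cases; `D₀` is reduced if all its multiplicities are `0` or `1`
    (hcase : k = 1 ∨ ((eP : ℤ) + eM = 0 ∧ ∀ p : ℂ, D₀ p = 0 ∨ D₀ p = 1))
    -- `α = 0` gives the polynomial `F` itself; larger `α` can be used to make the weights positive
    (α : ℕ) :
    -- the affine hypersurface `F(x, y, 1, s) = 0` is normal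
    (IsDomain (MvPolynomial (Fin 3) ℂ ⧸
        Ideal.span {dehomogenize (surfacePoly d k eP eM Q α)}) ∧
      IsIntegrallyClosed (MvPolynomial (Fin 3) ℂ ⧸
        Ideal.span {dehomogenize (surfacePoly d k eP eM Q α)})) ∧
    -- whatever the sign of the weight of `y`, `A` is the coordinate ring of `D₊(z)` in `F = 0`
    (∃ hF : MvPolynomial.IsWeightedHomogeneous
        (![(eP : ℤ), k * eM + d * (Q.natDegree + α), (d : ℤ), 1] : Fin 4 → ℤ)
        (surfacePoly d k eP eM Q α) (k * (eP + eM) + d * (Q.natDegree + α)),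
      ∃ ψ : dpdRing Dp Dm hD ≃+* ChartRing _ _ hF,
        (∀ (c : ℂ) (a : dpdRing Dp Dm hD), ψ (c • a) = c • ψ a) ∧
        ∀ (l : ℂˣ) (a : dpdRing Dp Dm hD), ψ (dpdTorus Dp Dm hD l a) =
          chartTorus _ _ hF k (torusScale_surfacePoly d k eP eM Q α) l (ψ a)) ∧
    -- if the weight `b` of `y` is not negative, `Spec A` is equivariantly isomorphic to the open
    -- subscheme `D₊(z)` of the hypersurface `V₊(F)` in the weighted projective space
    ∀ b : ℕ, (b : ℤ) = k * eM + d * (Q.natDegree + α) →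
      ∃ hF : MvPolynomial.IsWeightedHomogeneous (![eP, b, d, 1] : Fin 4 → ℕ)
          (surfacePoly d k eP eM Q α) (k * eP + b),
        ∃ j : Spec (CommRingCat.of (dpdRing Dp Dm hD)) ⟶ Hypersurface _ _ hF,
          IsOpenImmersion j ∧
          Set.range j = (Proj.basicOpen (hypGrading _ _ hF) (zClass _) :
            Set (Hypersurface _ _ hF)) ∧
          j ≫ hypersurfaceToSpec _ _ hF =
            Spec.map (CommRingCat.ofHom (algebraMap ℂ (dpdRing Dp Dm hD))) ∧
          (∀ l : ℂˣ, Spec.map (CommRingCat.ofHom (dpdTorus Dp Dm hD l).toRingHom) ≫ j =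
            j ≫ hypersurfaceTorus _ _ hF k (torusScale_surfacePoly d k eP eM Q α) l) ∧
          IsImmersion (j ≫ hypInclusion _ _ hF) ∧
          Set.range (j ≫ hypInclusion _ _ hF) =
            (Proj.basicOpen (polyGrading (![eP, b, d, 1] : Fin 4 → ℕ)) (MvPolynomial.X 2) :
              Set (WeightedProj ![eP, b, d, 1])) ∩
            ProjectiveSpectrum.zeroLocus (polyGrading (![eP, b, d, 1] : Fin 4 → ℕ))
              {surfacePoly d k eP eM Q α} := by
  have H := IsPresentation.of_divisors hD heP hePd hk hDp hDm hD₀ hQ hdiv hcase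
  refine ⟨?_, ⟨isWeightedHomogeneous_surfacePoly H.add_nonneg Q α,
    exists_dpdRing_equiv_chartRing _ (AddMonoidHom.id ℤ) Function.injective_id rfl hD H⟩, ?_⟩
  · rw [dehomogenize_surfacePoly]
    refine isIntegrallyClosed_affineQuotient hk ((Polynomial.expand_ne_zero H.d_pos).mpr hQ)
      (rootMultiplicity_expand_zero H.d_pos hQ H.rootMultiplicity_zero)
      (H.cases.imp_right fun h => ⟨by simp [h.1], ?_⟩)
    exact rootMultiplicity_expand_le_one H.d_pos hQ H.rootMultiplicity_zero h.2
  · intro b hb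
    -- The hypothesis on `b` says that the natural weights become the integral ones under `ℕ → ℤ`,
    -- so the ring isomorphism is available for the `ℕ`-grading as well.
    have hw : Nat.castAddMonoidHom ℤ ∘ (![eP, b, d, 1] : Fin 4 → ℕ) =
        intWeights d k eP eM (Q.natDegree + α) := by
      funext i
      fin_cases i <;> simp [intWeights, hb]
    have hF : MvPolynomial.IsWeightedHomogeneous (![eP, b, d, 1] : Fin 4 → ℕ)
        (surfacePoly d k eP eM Q α) (k * eP + b) := by
      rw [← isWeightedHomogeneous_comp_iff (Nat.castAddMonoidHom ℤ) Nat.cast_injective, hw]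
      convert! isWeightedHomogeneous_surfacePoly H.add_nonneg Q α using 1
      simp only [Nat.coe_castAddMonoidHom, Nat.cast_add, Nat.cast_mul, hb]
      ring
    obtain ⟨ψ, hψ, hψτ⟩ := exists_dpdRing_equiv_chartRing hF (Nat.castAddMonoidHom ℤ)
      Nat.cast_injective hw hD H
    have hz : 0 < (![eP, b, d, 1] : Fin 4 → ℕ) 2 := H.d_pos
    exact ⟨hF, toHypersurface _ _ hF hz ψ, inferInstance, range_toHypersurface _ _ hF hz ψ,
      toHypersurface_toSpec _ _ hF hz ψ hψ,
      fun l => map_comp_toHypersurface _ _ hF hz ψ k _ l _ (hψτ l),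
      isImmersion_toHypersurface_hypInclusion _ _ hF hz ψ,
      range_toHypersurface_hypInclusion _ _ hF hz ψ⟩
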